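/- \textbf{Setting.} Let $N\ge 2$, $n\ge 1$. Consider $N$ agents $\dot x_i=Ax_i+Bu_i$, $x_i(t)\in\mathbb R^n$, $u_i(t)\in\mathbb R^m$, on a directed graph with adjacency entries $a_{ij}=1$ if $j\in\mathcal N_i$ (agent $i$ receives information from agent $j$) and $a_{ij}=0$ otherwise, and Laplacian $\mathcal L=\mathrm{diag}(\sum_j a_{ij})-(a_{ij})$. Assume that the graph has a directed spanning tree and that $(A,B)$ is controllable. Let $\alpha>0$, let $P$ be symmetric positive definite with $PA+A^TP-2PBB^TP+2\alpha P<0$, put $F=-B^TP$, and let $c\in\mathbb R$ satisfy $c\ge 1/\mathrm{Re}(\mu)$ for every nonzero eigenvalue $\mu$ of $\mathcal L$. Let $S_L$ be invertible with $S_L^{-1}\mathcal LS_L=\mathrm{diag}(0,J_{2:N})$ in Jordan canonical form, and put $\hat A=I_{N-1}\otimes A+cJ_{2:N}\otimes BF$, $\hat B=c\,[0\;J_{2:N}]S_L^{-1}\otimes BF$, $\Theta=S_L\begin{bmatrix}0\\J_{2:N}\end{bmatrix}$, and $\hat x_{2:N}$ = the last $N-1$ blocks of $(S_L^{-1}\otimes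 I_n)x$. Norms are Euclidean and induced Euclidean norms. \textbf{Delayed event-triggered loop.} Let $d\ge0$ be the communication delay. Agent $i$ has event times $0=t_0<t_1<\cdots$ (depending on $i$; finitely or infinitely many). Its own model satisfies $\dot y_i=Ay_i$ on $[t_k,t_{k+1})$, $y_i(t_k)=x_i(t_k)$, and the next event time $t_{k+1}$ is the first time after $t_k$ at which $\|e_i\|$, $e_i=y_i-x_i$, reaches $\beta e^{-\lambda t}$ (before the reset of $y_i$). Its delayed model satisfies $\dot y_i^d=Ay_i^d$ on $[t_k+d,t_{k+1}+d)$, $y_i^d(t_k+d)=e^{Ad}x_i(t_k)$, and on $[0,d)$ it satisfies $\dot y_i^d=Ay_i^d$ with $\|y_i^d(0)-x_i(0)\|\le\beta$. The inputs are $u_i=cF\sum_{j\in\mathcal N_i}(y_i^d-y_j^d)$. A run of the loop lives on $[0,T)$, where $T\in(0,\infty]$ is the first time at which the event times of some agent accumulate ($T=\infty$ if there is no such time). \textbf{Theorem.} There are $\hat\beta,\hat\lambda>0$ with $\|e^{\hat At}\|\le\hat\beta e^{-\hat\lambda t}$ for all $t\ge0$. Let $\hat\beta>0$ and $\hat\lambda$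 be any numbers with this property, let $0<\lambda<\hat\lambda$ and $0<\beta<\gamma$, and let an initial state $x(0)$ be given. For $s\ge0$ put $$H_1=\|\Theta\|\Big(\hat\beta\|\hat x_{2:N}(0)\|-\tfrac{\sqrt N\gamma\hat\beta\|\hat B\|}{\hat\lambda-\lambda}\Big),\quad H_2=\|\Theta\|\tfrac{\sqrt N\gamma\hat\beta\|\hat B\|}{\hat\lambda-\lambda}+\|\mathcal L\|\sqrt N\gamma,$$ $$H_3(s)=\|cBF\|\Big(\tfrac{H_1e^{(\lambda-\hat\lambda)s}}{\|A\|+\hat\lambda}+\tfrac{H_2}{\|A\|+\lambda}\Big),\quad \tau(s)=\frac{\ln(1+\beta/H_3(s))}{\|A\|+\hat\lambda},\quad \epsilon(s)=\frac{\ln\frac{\gamma+H_3(s)}{\beta+H_3(s)}}{\|A\|+\hat\lambda}.$$ Then $H_3(s)>0$ for all $s\ge 0$, and $\epsilon:=\inf_{s\ge0}\epsilon(s)>0$, $\tau_0:=\inf_{s\ge0}\tau(s)>0$. For every constant delay $d\in[0,\epsilon)$, every run of the loop from $x(0)$ exists for all time ($T=\infty$), with finitely many events of each agent in every bounded time interval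 (no Zeno behavior), the agents reach consensus asymptotically, $\|x_i(t)-x_j(t)\|\to0$ as $t\to\infty$ for all $i,j$, and any two consecutive event times of an agent satisfy $t_{k+1}-t_k\ge\tau(t_k)\ge\tau_0>0$. -/

import Mathlib

open Set Filter Topology
open scoped Matrix Kronecker
-- Every matrix norm below is the operator norm induced by the Euclidean norms.
open scoped Matrix.Norms.L2Operator

noncomputable section

namespace EventConsensus

/-- State space of one agent: `ℝⁿ` with the Euclidean norm. -/
abbrev State (n : ℕ) : Type := EuclideanSpace ℝ (Fin n)

/-- The data of a multi-agent system with `N = M + 1` identical linear agents: the system matrices,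
the feedback matrix `F`, the coupling gain `c`, and the directed communication graph, where
`graph.Adj i j` means that `(i, j)` is an edge, i.e. agent `j` obtains information from agent `i`. -/
structure Network (M n m : ℕ) where
  A : Matrix (Fin n) (Fin n) ℝ
  B : Matrix (Fin n) (Fin m) ℝ
  F : Matrix (Fin m) (Fin n) ℝ
  c : ℝ
  graph : Digraph (Fin (M + 1))

/-- Controllability of the pair `(A, B)`: the matrix `[B, AB, …, Aⁿ⁻¹B]` has full rank `n`. -/
def Controllable {n m : ℕ} (A : Matrix (Fin n) (Fin n) ℝ) (B : Matrix (Fin n) (Fin m) ℝ) : Prop :=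
  (Matrix.of fun (i : Fin n) (p : Fin n × Fin m) => (A ^ (p.1 : ℕ) * B) i p.2).rank = n

/-- A directed spanning tree: some vertex has directed paths to all others. -/
def HasSpanningTree {V : Type*} (G : Digraph V) : Prop :=
  ∃ r : V, ∀ v : V, Relation.ReflTransGen G.Adj r v

/-- A matrix in Jordan canonical form: only the diagonal and the first superdiagonal may be nonzero,
a superdiagonal entry is `0` or `1`, and it is `1` only between equal diagonal entries. -/
def IsJordanForm {p : ℕ} (J : Matrix (Fin p) (Fin p) ℂ) : Prop :=
  (∀ i j : Fin p, (j : ℕ) ≠ i → (j : ℕ) ≠ i + 1 → J i j = 0) ∧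
  (∀ i j : Fin p, (j : ℕ) = i + 1 → J i j = 0 ∨ (J i j = 1 ∧ J i i = J j j))

namespace Network

variable {M n m : ℕ} (net : Network M n m)

open Classical in
/-- The adjacency matrix: `a_ij = 1` if `(j, i)` is an edge, and `0` otherwise. -/
def adjacency : Matrix (Fin (M + 1)) (Fin (M + 1)) ℝ :=
  Matrix.of fun i j => if net.graph.Adj j i then 1 else 0

/-- The Laplacian `D - A` with the in-degree matrix `D`. -/
def laplacian : Matrix (Fin (M + 1)) (Fin (M + 1)) ℝ :=
  Matrix.diagonal (fun i => ∑ j, net.adjacency i j) - net.adjacency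

/-- The complexified Laplacian. -/
def laplacianC : Matrix (Fin (M + 1)) (Fin (M + 1)) ℂ := net.laplacian.map Complex.ofReal

open Classical in
/-- The input `u_i = c F ∑_{j ∈ N_i} (v_i - v_j)` computed from model states `v`. -/
def input (v : Fin (M + 1) → State n) (i : Fin (M + 1)) : EuclideanSpace ℝ (Fin m) :=
  net.c • Matrix.toEuclideanLin net.F
    (∑ j ∈ Finset.univ.filter (fun j => net.graph.Adj j i), (v i - v j))

/-- The matrix `c B F`. -/
def cBF : Matrix (Fin n) (Fin n) ℝ := net.c • (net.B * net.F)

/-- `S` transforms the Laplacian into a Jordan canonical form `S⁻¹ L S` that starts with the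
eigenvalue `0`. -/
def IsJordanTransform (S : Matrix (Fin (M + 1)) (Fin (M + 1)) ℂ) : Prop :=
  IsUnit S.det ∧ IsJordanForm (S⁻¹ * net.laplacianC * S) ∧ (S⁻¹ * net.laplacianC * S) 0 0 = 0

/-- The lower right block `J_{2:N}` of the Jordan form. -/
def J (S : Matrix (Fin (M + 1)) (Fin (M + 1)) ℂ) : Matrix (Fin M) (Fin M) ℂ :=
  (S⁻¹ * net.laplacianC * S).submatrix Fin.succ Fin.succ

/-- `Â = I ⊗ A + c J_{2:N} ⊗ B F`. -/
def AHat (S : Matrix (Fin (M + 1)) (Fin (M + 1)) ℂ) : Matrix (Fin M × Fin n) (Fin M × Fin n) ℂ :=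
  (1 : Matrix (Fin M) (Fin M) ℂ) ⊗ₖ net.A.map Complex.ofReal +
    ((net.c : ℂ) • net.J S) ⊗ₖ (net.B * net.F).map Complex.ofReal

/-- `B̂ = c Δ ⊗ B F`, where `Δ = [0 J_{2:N}] S⁻¹`. -/
def BHat (S : Matrix (Fin (M + 1)) (Fin (M + 1)) ℂ) :
    Matrix (Fin M × Fin n) (Fin (M + 1) × Fin n) ℂ :=
  ((net.c : ℂ) • (net.J S * S⁻¹.submatrix Fin.succ id)) ⊗ₖ (net.B * net.F).map Complex.ofReal

/-- `Θ = S [0 ; J_{2:N}]`. -/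
def Theta (S : Matrix (Fin (M + 1)) (Fin (M + 1)) ℂ) : Matrix (Fin (M + 1)) (Fin M) ℂ :=
  S.submatrix id Fin.succ * net.J S

/-- `‖exp(Â t)‖ ≤ β̂ exp(-λ̂ t)` for all `t ≥ 0`. -/
def DecayBound (S : Matrix (Fin (M + 1)) (Fin (M + 1)) ℂ) (betaHat lamHat : ℝ) : Prop :=
  ∀ t : ℝ, 0 ≤ t → ‖NormedSpace.exp ((t : ℂ) • net.AHat S)‖ ≤ betaHat * Real.exp (-lamHat * t)

end Network

/-- The components `2, …, N` of `x̂ = (S⁻¹ ⊗ I) x`. -/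
def xHatTail {M n : ℕ} (S : Matrix (Fin (M + 1)) (Fin (M + 1)) ℂ) (x : Fin (M + 1) → State n) :
    EuclideanSpace ℂ (Fin M × Fin n) :=
  WithLp.toLp 2 fun p => ∑ j, S⁻¹ p.1.succ j * (x j p.2 : ℂ)

namespace Network

variable {M n m : ℕ} (net : Network M n m)

/-- `√N γ β̂ ‖B̂‖ / (λ̂ - λ)`. -/
def gainQ (S : Matrix (Fin (M + 1)) (Fin (M + 1)) ℂ) (gam lam betaHat lamHat : ℝ) : ℝ :=
  Real.sqrt (M + 1 : ℕ) * gam * betaHat * ‖net.BHat S‖ / (lamHat - lam)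

/-- `H₁ = ‖Θ‖ (β̂ ‖x̂_{2:N}(0)‖ - √N γ β̂ ‖B̂‖ / (λ̂ - λ))`. -/
def H₁ (S : Matrix (Fin (M + 1)) (Fin (M + 1)) ℂ) (x₀ : Fin (M + 1) → State n)
    (gam lam betaHat lamHat : ℝ) : ℝ :=
  ‖net.Theta S‖ * (betaHat * ‖xHatTail S x₀‖ - net.gainQ S gam lam betaHat lamHat)

/-- `H₂ = ‖Θ‖ √N γ β̂ ‖B̂‖ / (λ̂ - λ) + ‖L‖ √N γ`. -/
def H₂ (S : Matrix (Fin (M + 1)) (Fin (M + 1)) ℂ) (gam lam betaHat lamHat : ℝ) : ℝ :=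
  ‖net.Theta S‖ * net.gainQ S gam lam betaHat lamHat +
    ‖net.laplacian‖ * Real.sqrt (M + 1 : ℕ) * gam

/-- `H₃` as a function of the triggering instant `s`. -/
def H₃ (S : Matrix (Fin (M + 1)) (Fin (M + 1)) ℂ) (x₀ : Fin (M + 1) → State n)
    (gam lam betaHat lamHat : ℝ) (s : ℝ) : ℝ :=
  ‖net.cBF‖ *
    (net.H₁ S x₀ gam lam betaHat lamHat * Real.exp ((lam - lamHat) * s) / (‖net.A‖ + lamHat) +
      net.H₂ S gam lam betaHat lamHat / (‖net.A‖ + lam))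

/-- `ε = ln((γ + H₃) / (β + H₃)) / (‖A‖ + λ̂)` as a function of the triggering instant `s`. -/
def epsAt (S : Matrix (Fin (M + 1)) (Fin (M + 1)) ℂ) (x₀ : Fin (M + 1) → State n)
    (bet gam lam betaHat lamHat : ℝ) (s : ℝ) : ℝ :=
  Real.log ((gam + net.H₃ S x₀ gam lam betaHat lamHat s) /
    (bet + net.H₃ S x₀ gam lam betaHat lamHat s)) / (‖net.A‖ + lamHat)

/-- `τ = ln(1 + β / H₃) / (‖A‖ + λ̂)` as a function of the triggering instant `s`. -/
def tauAt (S : Matrix (Fin (M + 1)) (Fin (M + 1)) ℂ) (x₀ : Fin (M + 1) → State n)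
    (bet gam lam betaHat lamHat : ℝ) (s : ℝ) : ℝ :=
  Real.log (1 + bet / net.H₃ S x₀ gam lam betaHat lamHat s) / (‖net.A‖ + lamHat)

end Network

/-- `ẏ = A y` on the interval `s` (one-sided derivatives at end points that belong to `s`). -/
def SolvesOn {n : ℕ} (A : Matrix (Fin n) (Fin n) ℝ) (y : ℝ → State n) (s : Set ℝ) : Prop :=
  ∀ r ∈ s, HasDerivWithinAt y (Matrix.toEuclideanLin A (y r)) s r

/-- A run on `[0, T)` of the closed loop with event threshold `bet * exp (-lam * t)` and constant
communication delay `d`: `x i` is the state of agent `i`, `y i` its own model, `yd i` its delayed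
model, and `t i k` its `k`-th event time, with `t i k = ⊤` if there are at most `k` events.
A run is maximal: it ends only where the event times of some agent accumulate, so that `T = ⊤`
unless the run exhibits Zeno behavior. -/
structure IsRun {M n m : ℕ} (net : Network M n m) (bet lam d : ℝ)
    (x y yd : Fin (M + 1) → ℝ → State n) (t : Fin (M + 1) → ℕ → EReal) (T : EReal) : Prop where
  /-- The run ends at the first accumulation point of the event times of an agent. -/
  horizon : T = ⨅ i, ⨆ k, t i k
  event_zero : ∀ i, t i 0 = 0
  event_lt : ∀ i k, t i k ≠ ⊤ → t i k < t i (k + 1)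
  event_top : ∀ i k, t i k = ⊤ → t i (k + 1) = ⊤
  event_horizon : ∀ i k, t i k ≠ ⊤ → t i k < T
  /-- Agent dynamics `ẋ_i = A x_i + B u_i`; the right derivative, as `u_i` jumps at updates. -/
  x_cont : ∀ i, ContinuousOn (x i) {s : ℝ | 0 ≤ s ∧ (s : EReal) < T}
  x_deriv : ∀ i (s : ℝ), 0 ≤ s → (s : EReal) < T →
    HasDerivWithinAt (x i)
      (Matrix.toEuclideanLin net.A (x i s) +
        Matrix.toEuclideanLin net.B (net.input (fun j => yd j s) i)) (Ici s) s
  /-- The local model `y_i` is reset to `x_i` at the events of agent `i`. -/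
  y_reset : ∀ i k (a : ℝ), t i k = a → y i a = x i a
  y_deriv : ∀ i k,
    SolvesOn net.A (y i) {s : ℝ | t i k ≤ s ∧ (s : EReal) < t i (k + 1) ∧ (s : EReal) < T}
  /-- The next event occurs exactly when `‖e_i‖` first reaches the threshold; at the event itself
  `e_i` is reset, so the value that triggers it is the left limit. -/
  no_event : ∀ i k (s : ℝ), t i k ≤ s → (s : EReal) < t i (k + 1) → (s : EReal) < T →
    ‖y i s - x i s‖ < bet * Real.exp (-lam * s)
  event : ∀ i k (b : ℝ), t i (k + 1) = b →
    Tendsto (fun s => ‖y i s - x i s‖) (𝓝[<] b) (𝓝 (bet * Real.exp (-lam * b)))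
  /-- The measurement of the event at `t i k` arrives at `t i k + d`; the delayed model is then
  updated to `exp (A d) x_i`. -/
  yd_update : ∀ i k (a : ℝ), t i k = a → ((a + d : ℝ) : EReal) < T →
    yd i (a + d) = Matrix.toEuclideanLin (NormedSpace.exp (d • net.A)) (x i a)
  yd_deriv : ∀ i k, SolvesOn net.A (yd i)
    {s : ℝ | t i k + (d : EReal) ≤ s ∧ (s : EReal) < t i (k + 1) + (d : EReal) ∧ (s : EReal) < T}
  /-- Before the first measurement arrives, the delayed model runs from an initial value whose
  error does not exceed the initial threshold. -/
  yd_init : ∀ i, ‖yd i 0 - x i 0‖ ≤ bet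
  yd_init_deriv : ∀ i, SolvesOn net.A (yd i) {s : ℝ | 0 ≤ s ∧ s < d ∧ (s : EReal) < T}

/-- Asymptotic consensus: all differences of agent states tend to zero. -/
def AchievesConsensus {M n : ℕ} (x : Fin (M + 1) → ℝ → State n) : Prop :=
  ∀ i j, Tendsto (fun s => ‖x i s - x j s‖) atTop (𝓝 0)

end EventConsensus

end

/-! Write `x̂` for the components 2, …, N of `S⁻¹ x`. They satisfy `x̂' = Â x̂ + B̂ e`, where `e`
stacks the errors of the delayed models, and the Laplacian sees only them: `L = Θ S⁻¹_{2:N}`.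
Suppose that all delayed errors are at most `γ e^{-λs}` before time `r`. Variation of constants with
the decay bound for `Â` controls `x̂`, and hence each input, `‖B u_i‖ ≤ ‖cBF‖ (H₁ e^{-λ̂s} + H₂
e^{-λs})`. Integration of this against `e^{‖A‖(r-s)}` from `a` shows that an agent departs from its
free motion by at most `e^{-λr} H₃(a) (e^{(‖A‖+λ̂)(r-a)} - 1)` (`norm_sub_agentFlow_le`).

Both constants can be read off from this bound. An event needs a departure of `β e^{-λr}`, which
takes at least the time `τ(a)`. An error of at most `β e^{-λb}` stays below `γ e^{-λr}` as long as
`r - b < ε(b)` (`norm_drift_lt`).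

The assumed error bound is itself what the delay condition yields, so the argument is a
continuation: at the infimum of the violation times the estimate uses only earlier errors and gives
strict inequality, and right continuity carries it beyond that time (`errorBound`). The gaps between
events are then at least `τ₀`, so no event times accumulate and the run is global. Finally `x̂ → 0`,
and differences of agents depend only on `x̂`, because the first column of `S` is constant.

Decay of `Â` comes from the Riccati inequality. In coordinates where `P` is the identity it says
that the Hermitian part of `A` is at most `G - α` with `G ≥ 0`. The gain condition gives `Re (cμ) ≥
1`, so each diagonal block `A - cμG` is dissipative, and a diagonal rescaling makes the Jordan
off-diagonal entries negligible (`exists_decayBound`). The graph enters through a minimum principle,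
which makes the eigenvalue 0 simple, and through Gershgorin discs, which put the other eigenvalues
in the right half plane. -/

namespace EventConsensus

/-! ### Linear flows and variation of constants. -/

section Flow

variable {E : Type*} [NormedAddCommGroup E] [NormedSpace ℝ E]

/-- The flow `exp (t A)` of the linear differential equation `ẋ = A x`. -/
noncomputable def flow (A : E →L[ℝ] E) (t : ℝ) : E →L[ℝ] E := NormedSpace.exp (t • A)

@[simp] lemma flow_zero (A : E →L[ℝ] E) : flow A 0 = 1 := by simp [flow]

variable [CompleteSpace E]

lemma hasDerivAt_flow (A : E →L[ℝ] E) (t : ℝ) : HasDerivAt (flow A) (flow A t * A) t :=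
  hasDerivAt_exp_smul_const A t

lemma hasDerivAt_flow' (A : E →L[ℝ] E) (t : ℝ) : HasDerivAt (flow A) (A * flow A t) t :=
  hasDerivAt_exp_smul_const' A t

lemma hasDerivAt_flow_apply (A : E →L[ℝ] E) (v : E) (t : ℝ) :
    HasDerivAt (fun s => flow A s v) (A (flow A t v)) t := by
  simpa using (hasDerivAt_flow' A t).clm_apply (hasDerivAt_const t v)

lemma flow_add (A : E →L[ℝ] E) (s t : ℝ) : flow A (s + t) = flow A s * flow A t := by
  let _ : NormedAlgebra ℚ (E →L[ℝ] E) := .restrictScalars ℚ ℝ (E →L[ℝ] E)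
  simp only [flow, add_smul]
  exact NormedSpace.exp_add_of_commute (((Commute.refl A).smul_left s).smul_right t)

lemma flow_add_apply (A : E →L[ℝ] E) (s t : ℝ) (v : E) :
    flow A (s + t) v = flow A s (flow A t v) := by
  rw [flow_add]; rfl

lemma continuous_flow_apply (A : E →L[ℝ] E) (v : E) : Continuous fun s => flow A s v :=
  continuous_iff_continuousAt.2 fun t => (hasDerivAt_flow_apply A v t).continuousAt

lemma norm_flow_apply_le (A : E →L[ℝ] E) {t : ℝ} (ht : 0 ≤ t) (v : E) :
    ‖flow A t v‖ ≤ Real.exp (‖A‖ * t) * ‖v‖ := by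
  have h := norm_le_gronwallBound_of_norm_deriv_right_le (f := fun s => flow A s v)
    (f' := fun s => A (flow A s v)) (δ := ‖v‖) (K := ‖A‖) (ε := 0) (a := 0) (b := t)
    (continuous_flow_apply A v).continuousOn
    (fun s _ => (hasDerivAt_flow_apply A v s).hasDerivWithinAt) (by simp)
    (fun s _ => by simpa using A.le_opNorm _) t (right_mem_Icc.2 ht)
  rwa [gronwallBound_ε0, sub_zero, mul_comm] at h

/-- Variation of constants as an estimate: a solution of `ẋ = A x + w` deviates from the free
motion by no more than the increment of a primitive of a bound for `exp (A (t - s)) w(s)`. -/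
lemma norm_sub_flow_le (A : E →L[ℝ] E) {x w : ℝ → E} {a t : ℝ} (hat : a ≤ t)
    (hx : ContinuousOn x (Icc a t))
    (hd : ∀ s ∈ Ico a t, HasDerivWithinAt x (A (x s) + w s) (Ici s) s)
    {G G' : ℝ → ℝ} (hG : ∀ s, HasDerivAt G (G' s) s)
    (hw : ∀ s ∈ Ico a t, ‖flow A (t - s) (w s)‖ ≤ G' s) :
    ‖x t - flow A (t - a) (x a)‖ ≤ G t - G a := by
  have hΦ : ∀ s, HasDerivAt (fun s => flow A (t - s)) (-(flow A (t - s) * A)) s := fun s => by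
    simpa [Function.comp_def] using HasDerivAt.scomp (h := fun s => t - s) s (hasDerivAt_flow A (t - s))
      ((hasDerivAt_id s).const_sub t)
  have hΦc : Continuous fun s => flow A (t - s) :=
    continuous_iff_continuousAt.2 fun s => (hΦ s).continuousAt
  -- In the derivative of `flow A (t - s) (x s)` the two terms with `A` cancel, which leaves `flow A
  -- (t - s) (w s)`. Comparison with `G` replaces integration.
  have h := image_norm_le_of_norm_deriv_right_le_deriv_boundary
    (f := fun s => flow A (t - s) (x s) - flow A (t - a) (x a))
    (f' := fun s => flow A (t - s) (w s)) (a := a) (b := t)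
    (B := fun s => G s - G a) (B' := G')
    ((hΦc.continuousOn.clm_apply hx).sub continuousOn_const)
    (fun s hs => by
      have := ((hΦ s).hasDerivWithinAt (s := Ici s)).clm_apply (hd s hs)
      refine (this.sub_const _).congr_deriv ?_
      simp)
    (by simp) (fun s => (hG s).sub_const _) hw (right_mem_Icc.2 hat)
  simpa using h

/-- Free motion is given by the flow. -/
lemma eq_flow (A : E →L[ℝ] E) {x : ℝ → E} {a t : ℝ} (hat : a ≤ t)
    (hx : ContinuousOn x (Icc a t))
    (hd : ∀ s ∈ Ico a t, HasDerivWithinAt x (A (x s)) (Ici s) s) :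
    x t = flow A (t - a) (x a) := by
  have h := norm_sub_flow_le A (w := 0) hat hx (fun s hs => by simpa using hd s hs)
    (G := 0) (G' := 0) (fun s => hasDerivAt_const s 0) (by simp)
  simpa [sub_eq_zero] using h

end Flow

/-! ### Matrices as operators on stacked Euclidean vectors. -/

section MatrixAction

/-- The real-linear action of a complex matrix on Euclidean space. -/
noncomputable def realCLM {ι : Type*} [Fintype ι] [DecidableEq ι] :
    Matrix ι ι ℂ →+* (EuclideanSpace ℂ ι →L[ℝ] EuclideanSpace ℂ ι) where
  toFun Q := (Matrix.toEuclideanCLM (n := ι) (𝕜 := ℂ) Q).restrictScalars ℝ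
  map_one' := by ext; simp
  map_mul' P Q := by ext; simp
  map_zero' := by ext; simp
  map_add' P Q := by ext; simp

lemma realCLM_apply {ι : Type*} [Fintype ι] [DecidableEq ι] (Q : Matrix ι ι ℂ)
    (v : EuclideanSpace ℂ ι) : realCLM Q v = Matrix.toEuclideanLin Q v := rfl

lemma continuous_realCLM {ι : Type*} [Fintype ι] [DecidableEq ι] :
    Continuous (realCLM (ι := ι)) := by
  have h : Continuous fun Q : Matrix ι ι ℂ => Matrix.toEuclideanCLM (n := ι) (𝕜 := ℂ) Q :=
    (Matrix.toEuclideanCLM (n := ι) (𝕜 := ℂ)).toAlgEquiv.toLinearMap.continuous_of_finiteDimensional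
  exact (ContinuousLinearMap.restrictScalarsL ℂ (EuclideanSpace ℂ ι) (EuclideanSpace ℂ ι)
    ℝ ℝ).continuous.comp h

lemma realCLM_exp {ι : Type*} [Fintype ι] [DecidableEq ι] (Q : Matrix ι ι ℂ) (t : ℝ)
    (v : EuclideanSpace ℂ ι) :
    Matrix.toEuclideanLin (NormedSpace.exp ((t : ℂ) • Q)) v = flow (realCLM Q) t v := by
  let _ : NormedAlgebra ℚ (Matrix ι ι ℂ) := .restrictScalars ℚ ℂ _
  have h := NormedSpace.map_exp (realCLM (ι := ι)) continuous_realCLM ((t : ℂ) • Q)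
  have h2 : realCLM ((t : ℂ) • Q) = t • realCLM Q := by
    ext v i
    simp [realCLM_apply, Matrix.toLpLin_apply, Matrix.smul_mulVec]
  rw [h2] at h
  rw [flow, ← h, realCLM_apply]

lemma toEuclideanCLM_exp {ι : Type*} [Fintype ι] [DecidableEq ι] (Q : Matrix ι ι ℝ) (t : ℝ)
    (v : EuclideanSpace ℝ ι) :
    Matrix.toEuclideanLin (NormedSpace.exp (t • Q)) v =
      flow (Matrix.toEuclideanCLM (n := ι) (𝕜 := ℝ) Q) t v := by
  have hc : Continuous fun Q : Matrix ι ι ℝ => Matrix.toEuclideanCLM (n := ι) (𝕜 := ℝ) Q :=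
    (Matrix.toEuclideanCLM (n := ι) (𝕜 := ℝ)).toAlgEquiv.toLinearMap.continuous_of_finiteDimensional
  let _ : NormedAlgebra ℚ (Matrix ι ι ℝ) := .restrictScalars ℚ ℝ _
  have h := NormedSpace.map_exp (Matrix.toEuclideanCLM (n := ι) (𝕜 := ℝ)) hc (t • Q)
  rw [map_smul] at h
  rw [flow, ← h]; rfl

lemma norm_toEuclideanLin_le {𝕜 ι κ : Type*} [RCLike 𝕜] [Fintype ι] [Fintype κ] [DecidableEq κ]
    (Q : Matrix ι κ 𝕜) (v : EuclideanSpace 𝕜 κ) : ‖Matrix.toEuclideanLin Q v‖ ≤ ‖Q‖ * ‖v‖ :=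
  Matrix.l2_opNorm_mulVec Q v

/-- A matrix acting on blocks, `Q ⊗ I`, is bounded by the norm of `Q`. -/
lemma norm_blockAction_le {𝕜 ι κ ν : Type*} [RCLike 𝕜] [Fintype ι] [Fintype κ] [DecidableEq κ]
    [Fintype ν] (Q : Matrix ι κ 𝕜) (z : EuclideanSpace 𝕜 (κ × ν)) :
    ‖(WithLp.toLp 2 fun p : ι × ν => ∑ j, Q p.1 j * z (j, p.2) : EuclideanSpace 𝕜 (ι × ν))‖ ≤
      ‖Q‖ * ‖z‖ := by
  refine (sq_le_sq₀ (norm_nonneg _) (by positivity)).1 ?_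
  -- With the inner coordinate `p` fixed, the block action is `Q` applied to one slice, so the
  -- squared bounds add up over `p`.
  rw [mul_pow, EuclideanSpace.norm_sq_eq, EuclideanSpace.norm_sq_eq, Fintype.sum_prod_type_right,
    Fintype.sum_prod_type_right, Finset.mul_sum]
  refine Finset.sum_le_sum fun p _ => ?_
  have h := norm_toEuclideanLin_le Q (WithLp.toLp 2 fun j => z (j, p))
  have h2 := pow_le_pow_left₀ (norm_nonneg _) h 2
  rw [mul_pow, EuclideanSpace.norm_sq_eq, EuclideanSpace.norm_sq_eq] at h2
  exact h2

/-- A block is no longer than the stacked vector. -/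
lemma norm_block_le {𝕜 ι ν : Type*} [RCLike 𝕜] [Fintype ι] [Fintype ν]
    (z : EuclideanSpace 𝕜 (ι × ν)) (i : ι) :
    ‖(WithLp.toLp 2 fun p => z (i, p) : EuclideanSpace 𝕜 ν)‖ ≤ ‖z‖ := by
  refine (sq_le_sq₀ (norm_nonneg _) (norm_nonneg _)).1 ?_
  rw [EuclideanSpace.norm_sq_eq, EuclideanSpace.norm_sq_eq, Fintype.sum_prod_type]
  exact Finset.single_le_sum (f := fun i => ∑ p, ‖z (i, p)‖ ^ 2)
    (fun _ _ => Finset.sum_nonneg fun _ _ => by positivity) (Finset.mem_univ i)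

lemma norm_stack_le {ι ν : Type*} [Fintype ι] [Fintype ν] (e : ι → EuclideanSpace ℝ ν) {b : ℝ}
    (hb : 0 ≤ b) (he : ∀ i, ‖e i‖ ≤ b) :
    ‖(WithLp.toLp 2 fun p : ι × ν => e p.1 p.2 : EuclideanSpace ℝ (ι × ν))‖ ≤
      Real.sqrt (Fintype.card ι) * b := by
  refine (sq_le_sq₀ (norm_nonneg _) (by positivity)).1 ?_
  rw [mul_pow, Real.sq_sqrt (by positivity), EuclideanSpace.norm_sq_eq, Fintype.sum_prod_type]
  calc _ ≤ ∑ i : ι, b ^ 2 := Finset.sum_le_sum fun i _ => by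
        have := pow_le_pow_left₀ (norm_nonneg _) (he i) 2
        rwa [EuclideanSpace.norm_sq_eq] at this
    _ = _ := by simp

lemma norm_complexify {ι : Type*} [Fintype ι] (z : EuclideanSpace ℝ ι) :
    ‖(WithLp.toLp 2 fun p => (z p : ℂ) : EuclideanSpace ℂ ι)‖ = ‖z‖ := by
  simp [EuclideanSpace.norm_eq]

end MatrixAction

/-! ### The Laplacian of a graph with a spanning tree. -/

namespace Network

variable {M n m : ℕ} (net : Network M n m)

lemma adjacency_nonneg (i j : Fin (M + 1)) : 0 ≤ net.adjacency i j := by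
  simp only [adjacency, Matrix.of_apply]; split_ifs <;> simp

lemma laplacian_mulVec (v : Fin (M + 1) → ℝ) (i : Fin (M + 1)) :
    (net.laplacian *ᵥ v) i = ∑ j, net.adjacency i j * (v i - v j) := by
  rw [laplacian, Matrix.sub_mulVec, Pi.sub_apply, Matrix.mulVec_diagonal]
  simp only [Matrix.mulVec, dotProduct, mul_sub, Finset.sum_sub_distrib, Finset.sum_mul]

/-- If the Laplacian maps `v` to a nonnegative vector, then `v` attains its minimum only if the
image vanishes there, and the minimum propagates against the edges. -/
lemma minimum_propagates {v : Fin (M + 1) → ℝ} {i : Fin (M + 1)}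
    (hv : 0 ≤ (net.laplacian *ᵥ v) i) (hi : ∀ j, v i ≤ v j) :
    (net.laplacian *ᵥ v) i = 0 ∧ ∀ j, net.graph.Adj j i → v j = v i := by
  rw [laplacian_mulVec] at hv ⊢
  have hle : ∀ j ∈ Finset.univ, net.adjacency i j * (v i - v j) ≤ 0 := fun j _ =>
    mul_nonpos_of_nonneg_of_nonpos (net.adjacency_nonneg i j) (sub_nonpos.2 (hi j))
  have h0 := le_antisymm (Finset.sum_nonpos hle) hv
  refine ⟨h0, fun j hj => ?_⟩
  have := (Finset.sum_eq_zero_iff_of_nonpos hle).1 h0 j (Finset.mem_univ j)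
  simp only [adjacency, Matrix.of_apply, if_pos hj, one_mul] at this
  linarith

/-- A directed path leads from the root to a minimizer of `v`; followed backwards, it carries the
minimum to the root. -/
lemma root_le {r : Fin (M + 1)} (hr : ∀ v, Relation.ReflTransGen net.graph.Adj r v)
    {v : Fin (M + 1) → ℝ} (hv : 0 ≤ net.laplacian *ᵥ v) (j : Fin (M + 1)) : v r ≤ v j := by
  obtain ⟨i, hi⟩ := Finite.exists_min v
  have key : ∀ k, Relation.ReflTransGen net.graph.Adj k i → v k = v i := by
    intro k hk
    induction hk using Relation.ReflTransGen.head_induction_on with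
    | refl => rfl
    | head h _ ih =>
      rw [← ih]
      exact (net.minimum_propagates (hv _) (fun j => ih ▸ hi j)).2 _ h
  exact key r (hr i) ▸ hi j

/-- The Laplacian of a graph with a spanning tree maps only constant vectors to constant vectors. -/
lemma const_of_laplacian_const (hgraph : HasSpanningTree net.graph) {v : Fin (M + 1) → ℝ} {w : ℝ}
    (hv : net.laplacian *ᵥ v = fun _ => w) : w = 0 ∧ ∀ i j, v i = v j := by
  obtain ⟨r, hr⟩ := hgraph
  have hneg : net.laplacian *ᵥ (-v) = fun _ => -w := by
    rw [Matrix.mulVec_neg, hv]; rfl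
  -- The sign of `w` decides whether the minimum principle applies to `v` or to `-v`; at the
  -- minimizer the constant image must vanish.
  have hw : w = 0 := by
    rcases le_total 0 w with h | h
    · obtain ⟨i, hi⟩ := Finite.exists_min v
      have := (net.minimum_propagates (by rw [hv]; exact h) hi).1
      rwa [hv] at this
    · obtain ⟨i, hi⟩ := Finite.exists_min (-v)
      have := (net.minimum_propagates (by rw [hneg]; simpa using h) hi).1
      rw [hneg] at this
      simpa using this
  subst hw
  have h1 := net.root_le hr (v := v) (by rw [hv]; exact le_rfl)
  have h2 := net.root_le hr (v := -v) (by rw [hneg]; simp [Pi.le_def])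
  have h3 : ∀ j, v j = v r := fun j => le_antisymm (by simpa using h2 j) (h1 j)
  exact ⟨rfl, fun i j => (h3 i).trans (h3 j).symm⟩

lemma const_of_laplacianC_const (hgraph : HasSpanningTree net.graph) {v : Fin (M + 1) → ℂ} {w : ℂ}
    (hv : net.laplacianC *ᵥ v = fun _ => w) : w = 0 ∧ ∀ i j, v i = v j := by
  have hre : net.laplacian *ᵥ (fun i => (v i).re) = fun _ => w.re := by
    ext i
    have := congrArg Complex.re (congrFun hv i)
    simpa [laplacianC, Matrix.mulVec, dotProduct] using this
  have him : net.laplacian *ᵥ (fun i => (v i).im) = fun _ => w.im := by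
    ext i
    have := congrArg Complex.im (congrFun hv i)
    simpa [laplacianC, Matrix.mulVec, dotProduct] using this
  obtain ⟨h1, h2⟩ := net.const_of_laplacian_const hgraph hre
  obtain ⟨h3, h4⟩ := net.const_of_laplacian_const hgraph him
  exact ⟨Complex.ext h1 h3, fun i j => Complex.ext (h2 i j) (h4 i j)⟩

lemma laplacian_ne_zero (hM : 1 ≤ M) (hgraph : HasSpanningTree net.graph) :
    net.laplacian ≠ 0 := by
  intro h
  have h1 := (net.const_of_laplacian_const hgraph (v := Pi.single 0 1) (w := 0)
    (by rw [h, Matrix.zero_mulVec]; rfl)).2 0 ⟨1, by omega⟩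
  have h2 : (⟨1, by omega⟩ : Fin (M + 1)) ≠ 0 := by simp [Fin.ext_iff]
  simp [h2] at h1

/-- Nonzero Laplacian eigenvalues have positive real part. -/
lemma re_pos_of_mem_spectrum {μ : ℂ} (hμ : μ ∈ spectrum ℂ net.laplacianC) (h0 : μ ≠ 0) :
    0 < μ.re := by
  rw [← Matrix.spectrum_toLin', ← Module.End.hasEigenvalue_iff_mem_spectrum] at hμ
  -- Gershgorin: self-loops cancel in the diagonal, so centre and radius of the disc are the same
  -- number `R ≥ 0`. From `|μ - R| ≤ R` follows `|μ|² ≤ 2 R Re μ`, which excludes `Re μ ≤ 0` for `μ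
  -- ≠ 0`.
  obtain ⟨k, hk⟩ := eigenvalue_mem_ball hμ
  have hoff : ∀ j ∈ Finset.univ.erase k, ‖net.laplacianC k j‖ = net.adjacency k j := by
    intro j hj
    have hjk : k ≠ j := (Finset.ne_of_mem_erase hj).symm
    simp [laplacianC, laplacian, Matrix.diagonal_apply_ne _ hjk,
      abs_of_nonneg (net.adjacency_nonneg k j)]
  have hdiag : net.laplacianC k k =
      ((∑ j ∈ Finset.univ.erase k, net.adjacency k j : ℝ) : ℂ) := by
    have := Finset.add_sum_erase Finset.univ (net.adjacency k) (Finset.mem_univ k)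
    simp only [laplacianC, laplacian, Matrix.map_apply, Matrix.sub_apply, Matrix.diagonal_apply_eq]
    congr 1
    linarith
  rw [Finset.sum_congr rfl hoff, hdiag, Metric.mem_closedBall, Complex.dist_eq] at hk
  set R := ∑ j ∈ Finset.univ.erase k, net.adjacency k j
  have hR : 0 ≤ R := Finset.sum_nonneg fun j _ => net.adjacency_nonneg k j
  have hsq := pow_le_pow_left₀ (norm_nonneg _) hk 2
  rw [Complex.sq_norm, Complex.normSq_apply] at hsq
  simp only [Complex.sub_re, Complex.sub_im, Complex.ofReal_re, Complex.ofReal_im, sub_zero] at hsq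
  have hpos : 0 < μ.re * μ.re + μ.im * μ.im := by
    rw [← Complex.normSq_apply]; exact Complex.normSq_pos.2 h0
  by_contra hneg
  have := mul_nonneg hR (sub_nonneg.2 (not_lt.1 hneg))
  nlinarith

/-! ### The Jordan form: simplicity of the eigenvalue 0 and block structure. -/

section Jordan

variable {net} {S : Matrix (Fin (M + 1)) (Fin (M + 1)) ℂ}

lemma laplacian_mul_eq (hS : net.IsJordanTransform S) :
    net.laplacianC * S = S * (S⁻¹ * net.laplacianC * S) := by
  rw [← Matrix.mul_assoc, ← Matrix.mul_assoc, Matrix.mul_nonsing_inv _ hS.1, Matrix.one_mul]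

lemma inv_mul_laplacian_eq (hS : net.IsJordanTransform S) :
    S⁻¹ * net.laplacianC = (S⁻¹ * net.laplacianC * S) * S⁻¹ := by
  rw [Matrix.mul_assoc _ S, Matrix.mul_nonsing_inv _ hS.1, Matrix.mul_one]

lemma mulVec_inj (hS : net.IsJordanTransform S) {v w : Fin (M + 1) → ℂ}
    (h : S *ᵥ v = S *ᵥ w) : v = w :=
  Matrix.mulVec_injective_of_isUnit ((Matrix.isUnit_iff_isUnit_det S).2 hS.1) h

lemma laplacian_mulVec_col (hS : net.IsJordanTransform S) (k : Fin (M + 1)) :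
    net.laplacianC *ᵥ S.col k = S *ᵥ (S⁻¹ * net.laplacianC * S).col k := by
  have h : ∀ Q : Matrix (Fin (M + 1)) (Fin (M + 1)) ℂ, Q.col k = Q *ᵥ Pi.single k 1 := fun Q => by
    simp
  rw [h S, h (S⁻¹ * _ * S), Matrix.mulVec_mulVec, Matrix.mulVec_mulVec, laplacian_mul_eq hS]

lemma jordan_col_zero (hS : net.IsJordanTransform S) (i : Fin (M + 1)) :
    (S⁻¹ * net.laplacianC * S) i 0 = 0 := by
  rcases eq_or_ne i 0 with rfl | hi
  · exact hS.2.2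
  · have := Fin.val_ne_of_ne hi
    refine hS.2.1.1 i 0 (fun h => this h.symm) (by simp)

/-- The first column of `S` lies in the kernel of the Laplacian. -/
lemma col_zero_const (hgraph : HasSpanningTree net.graph) (hS : net.IsJordanTransform S)
    (i j : Fin (M + 1)) : S i 0 = S j 0 := by
  refine (net.const_of_laplacianC_const hgraph (v := S.col 0) (w := 0) ?_).2 i j
  rw [laplacian_mulVec_col hS]
  have : (S⁻¹ * net.laplacianC * S).col 0 = 0 := by ext i; exact jordan_col_zero hS i
  rw [this, Matrix.mulVec_zero]; rfl

/-- The eigenvalue `0` of the Laplacian is simple. -/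
lemma jordan_diag_ne_zero (hgraph : HasSpanningTree net.graph) (hS : net.IsJordanTransform S)
    {k : Fin (M + 1)} (hk : k ≠ 0) : (S⁻¹ * net.laplacianC * S) k k ≠ 0 := by
  set Λ := S⁻¹ * net.laplacianC * S with hΛ
  have hS00 : S 0 0 ≠ 0 := by
    intro h
    have : S *ᵥ Pi.single 0 1 = S *ᵥ 0 := by
      ext i
      simp [col_zero_const hgraph hS i 0, h]
    simpa using congrFun (mulVec_inj hS this) 0
  -- A further zero on the diagonal would start a second block for 0 or lengthen the first one. The
  -- induction runs along the superdiagonal.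
  induction hp : (k : ℕ) generalizing k with
  | zero => exact absurd (Fin.ext hp) hk
  | succ p ih =>
    intro h0
    have hpk : p < M + 1 := by have := k.2; omega
    -- the column `k` has at most one nonzero entry, in row `p`
    have hcol : ∀ i : Fin (M + 1), i ≠ ⟨p, hpk⟩ → Λ i k = 0 := by
      intro i hi
      rcases eq_or_ne i k with rfl | hik
      · exact h0
      · refine hS.2.1.1 i k (fun h => hik (Fin.ext h.symm)) fun h => hi (Fin.ext ?_)
        simp only; omega
    have hcol' : Λ.col k = Pi.single ⟨p, hpk⟩ (Λ ⟨p, hpk⟩ k) := by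
      ext i
      by_cases hi : i = ⟨p, hpk⟩
      · subst hi; simp
      · simp [hi, hcol i hi]
    -- If the superdiagonal entry is 1, then `Λ p p = Λ k k = 0`, so the induction hypothesis forces
    -- `p = 0` and the image is the constant first column. If it is 0, the image is zero.
    have hL : ∃ w, net.laplacianC *ᵥ S.col k = fun _ => w := by
      rw [laplacian_mulVec_col hS, ← hΛ, hcol']
      rcases hS.2.1.2 ⟨p, hpk⟩ k (by simp [hp]) with h | ⟨h, hpp⟩
      · refine ⟨0, ?_⟩
        rw [← hΛ] at h
        rw [h, Pi.single_zero, Matrix.mulVec_zero]; rfl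
      · rw [← hΛ] at h hpp
        rw [h0] at hpp
        have hp0 : (⟨p, hpk⟩ : Fin (M + 1)) = 0 := by
          by_contra hne
          exact ih hne rfl hpp
        refine ⟨S 0 0, ?_⟩
        rw [h, hp0]
        ext i
        simp [col_zero_const hgraph hS i 0]
    obtain ⟨w, hw⟩ := hL
    have hconst := (net.const_of_laplacianC_const hgraph hw).2
    -- Columns `k` and 0 are both constant, hence linearly dependent, against the invertibility of
    -- `S`.
    have : S *ᵥ Pi.single k (S 0 0) = S *ᵥ Pi.single 0 (S 0 k) := by
      ext i
      have h1 := hconst i 0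
      simp only [Matrix.col_apply] at h1
      simp [h1, col_zero_const hgraph hS i 0, mul_comm]
    have h2 := congrFun (mulVec_inj hS this) k
    simp [hk] at h2
    exact hS00 h2

lemma jordan_row_zero (hgraph : HasSpanningTree net.graph) (hS : net.IsJordanTransform S)
    (k : Fin M) : (S⁻¹ * net.laplacianC * S) 0 k.succ = 0 := by
  by_cases h : (k.succ : ℕ) = 1
  · rcases hS.2.1.2 0 k.succ (by simpa using h) with h | ⟨_, h⟩
    · exact h
    · exact absurd (h.symm.trans hS.2.2) (jordan_diag_ne_zero hgraph hS (Fin.succ_ne_zero k))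
  · exact hS.2.1.1 0 k.succ (by simp) (by simpa using h)

/-- The similar matrix `Λ k k - Λ` is upper triangular with a zero on its diagonal, hence singular.
-/
lemma jordan_diag_mem_spectrum (hS : net.IsJordanTransform S) (k : Fin (M + 1)) :
    (S⁻¹ * net.laplacianC * S) k k ∈ spectrum ℂ net.laplacianC := by
  set Λ := S⁻¹ * net.laplacianC * S with hΛ
  rw [spectrum.mem_iff]
  intro hu
  have hSu := (Matrix.isUnit_iff_isUnit_det S).2 hS.1
  have hSi : IsUnit S⁻¹ := by rwa [Matrix.isUnit_nonsing_inv_iff]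
  have h1 := (hSi.mul hu).mul hSu
  have h2 : S⁻¹ * ((algebraMap ℂ (Matrix (Fin (M + 1)) (Fin (M + 1)) ℂ)) (Λ k k) - net.laplacianC) * S
      = (algebraMap ℂ (Matrix (Fin (M + 1)) (Fin (M + 1)) ℂ)) (Λ k k) - Λ := by
    rw [mul_sub, sub_mul, ← hΛ, ← Algebra.commutes, mul_assoc, Matrix.nonsing_inv_mul _ hS.1,
      mul_one]
  rw [h2, Matrix.isUnit_iff_isUnit_det, Matrix.det_of_isUpperTriangular] at h1
  · refine h1.ne_zero (Finset.prod_eq_zero (Finset.mem_univ k) ?_)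
    simp [Matrix.algebraMap_matrix_apply]
  · intro i j hij
    have hij' : j < i := hij
    have : Λ i j = 0 := hS.2.1.1 i j (by omega) (by omega)
    simp [Matrix.algebraMap_matrix_apply, this, hij'.ne']

/-- `S⁻¹ L = diag(0, J) S⁻¹` in the rows `2, …, N`. -/
lemma inv_mul_laplacian_tail (hS : net.IsJordanTransform S) :
    (S⁻¹ * net.laplacianC).submatrix Fin.succ id = net.J S * S⁻¹.submatrix Fin.succ id := by
  ext i j
  rw [inv_mul_laplacian_eq hS, Matrix.submatrix_apply, Matrix.mul_apply, Fin.sum_univ_succ,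
    jordan_col_zero hS, zero_mul, zero_add]
  rfl

/-- `L S = S diag(0, J)` in the columns `2, …, N`. -/
lemma laplacian_mul_tail (hgraph : HasSpanningTree net.graph) (hS : net.IsJordanTransform S) :
    (net.laplacianC * S).submatrix id Fin.succ = net.Theta S := by
  ext i j
  rw [laplacian_mul_eq hS]
  simp only [Matrix.submatrix_apply, Theta, Matrix.mul_apply (M := S), Fin.sum_univ_succ (n := M),
    jordan_row_zero hgraph hS, mul_zero, zero_add, id]
  rfl

/-- `L = Θ S⁻¹_{2:N}`. -/
lemma laplacian_eq_theta_mul (hgraph : HasSpanningTree net.graph) (hS : net.IsJordanTransform S) :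
    net.laplacianC = net.Theta S * S⁻¹.submatrix Fin.succ id := by
  have h : net.laplacianC = net.laplacianC * S * S⁻¹ := by
    rw [Matrix.mul_assoc, Matrix.mul_nonsing_inv _ hS.1, Matrix.mul_one]
  have h0 : ∀ i, (net.laplacianC * S) i 0 = 0 := fun i => by
    rw [laplacian_mul_eq hS, Matrix.mul_apply]
    simp [jordan_col_zero hS]
  rw [← laplacian_mul_tail hgraph hS]
  conv_lhs => rw [h]
  ext i j
  rw [Matrix.mul_apply, Fin.sum_univ_succ, h0 i]
  simp [Matrix.mul_apply (M := Matrix.submatrix _ _ _)]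

/-- Differences of components depend only on the components `2, …, N` of `S⁻¹ x`. -/
lemma sub_eq_sum_tail (hgraph : HasSpanningTree net.graph) (hS : net.IsJordanTransform S)
    (v : Fin (M + 1) → ℂ) (i j : Fin (M + 1)) :
    v i - v j = ∑ k : Fin M, (S i k.succ - S j k.succ) * (S⁻¹ *ᵥ v) k.succ := by
  have h : v = S *ᵥ (S⁻¹ *ᵥ v) := by
    rw [Matrix.mulVec_mulVec, Matrix.mul_nonsing_inv _ hS.1, Matrix.one_mulVec]
  have hi : ∀ i, v i = S i 0 * (S⁻¹ *ᵥ v) 0 + ∑ k : Fin M, S i k.succ * (S⁻¹ *ᵥ v) k.succ := by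
    intro i
    conv_lhs => rw [h]
    rw [Matrix.mulVec, dotProduct, Fin.sum_univ_succ]
  rw [hi i, hi j, col_zero_const hgraph hS i j]
  simp [sub_mul]

/-- The gain condition in terms of the Jordan form. -/
lemma one_le_gain_mul_re (hgraph : HasSpanningTree net.graph) (hS : net.IsJordanTransform S)
    (hc : ∀ μ ∈ spectrum ℂ net.laplacianC, μ ≠ 0 → 1 / μ.re ≤ net.c) (k : Fin M) :
    1 ≤ net.c * (net.J S k k).re := by
  have h0 : net.J S k k ≠ 0 := jordan_diag_ne_zero hgraph hS (Fin.succ_ne_zero k)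
  have hmem : net.J S k k ∈ spectrum ℂ net.laplacianC := jordan_diag_mem_spectrum hS k.succ
  exact (div_le_iff₀ (net.re_pos_of_mem_spectrum hmem h0)).1 (hc _ hmem h0)

lemma gain_pos (hM : 1 ≤ M) (hgraph : HasSpanningTree net.graph) (hS : net.IsJordanTransform S)
    (hc : ∀ μ ∈ spectrum ℂ net.laplacianC, μ ≠ 0 → 1 / μ.re ≤ net.c) : 0 < net.c := by
  have h0 : net.J S ⟨0, hM⟩ ⟨0, hM⟩ ≠ 0 := jordan_diag_ne_zero hgraph hS (Fin.succ_ne_zero _)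
  have hmem : net.J S ⟨0, hM⟩ ⟨0, hM⟩ ∈ spectrum ℂ net.laplacianC :=
    jordan_diag_mem_spectrum hS (Fin.succ ⟨0, hM⟩)
  exact (one_div_pos.2 (net.re_pos_of_mem_spectrum hmem h0)).trans_le (hc _ hmem h0)

end Jordan

end Network

/-! ### Exponential decay of `Â` from the Riccati inequality. -/

section Dissipative

variable {ι : Type*} [Fintype ι] [DecidableEq ι]

/-- A matrix that is dissipative in suitable coordinates generates a decaying exponential. -/
lemma norm_exp_le_of_dissipative {Q Q' T T' : Matrix ι ι ℂ} (hT : T' * T = 1)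
    (hTQ : T * Q = Q' * T) {δ : ℝ}
    (hQ' : ∀ w : EuclideanSpace ℂ ι,
      (inner ℂ w (Matrix.toEuclideanLin Q' w)).re ≤ -δ * ‖w‖ ^ 2) {t : ℝ} (ht : 0 ≤ t) :
    ‖NormedSpace.exp ((t : ℂ) • Q)‖ ≤ ‖T'‖ * ‖T‖ * Real.exp (-δ * t) := by
  have hfl : ∀ v : EuclideanSpace ℂ ι, ‖realCLM T (flow (realCLM Q) t v)‖ ≤
      Real.exp (-δ * t) * ‖realCLM T v‖ := by
    intro v
    set u : ℝ → EuclideanSpace ℂ ι := fun s => realCLM T (flow (realCLM Q) s v) with hu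
    have hTQ' : ∀ z, realCLM T (realCLM Q z) = realCLM Q' (realCLM T z) := fun z => by
      have := congrArg (fun X => realCLM X z) hTQ
      simpa only [map_mul, mul_apply_eq_comp] using this
    have hud : ∀ s, HasDerivAt u (realCLM Q' (u s)) s := fun s => by
      have := (realCLM T).hasFDerivAt.comp_hasDerivAt s (hasDerivAt_flow_apply (realCLM Q) v s)
      rwa [hTQ'] at this
    -- Lyapunov function: in the coordinates `T`, dissipativity makes the weighted squared norm
    -- nonincreasing.
    have hg : ∀ s, HasDerivAt (fun s => Real.exp (2 * δ * s) * ‖u s‖ ^ 2)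
        (Real.exp (2 * δ * s) * (2 * δ) * ‖u s‖ ^ 2 +
          Real.exp (2 * δ * s) * (2 * (inner ℂ (u s) (realCLM Q' (u s))).re)) s := by
      intro s
      have h1 := (hud s).inner ℂ (hud s)
      have h2 := Complex.reCLM.hasFDerivAt.comp_hasDerivAt s h1
      have h3 : HasDerivAt (fun s => ‖u s‖ ^ 2)
          (2 * (inner ℂ (u s) (realCLM Q' (u s))).re) s := by
        have hsymm : (inner ℂ (realCLM Q' (u s)) (u s)).re =
            (inner ℂ (u s) (realCLM Q' (u s))).re := inner_re_symm (𝕜 := ℂ) _ _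
        refine (h2.congr_deriv ?_).congr_of_eventuallyEq (.of_forall fun s => ?_)
        · simp [hsymm, two_mul]
        · exact norm_sq_eq_re_inner (𝕜 := ℂ) (u s)
      have h4 : HasDerivAt (fun s => Real.exp (2 * δ * s)) (Real.exp (2 * δ * s) * (2 * δ)) s := by
        simpa using ((hasDerivAt_id s).const_mul (2 * δ)).exp
      exact h4.mul h3
    have hanti : Antitone fun s => Real.exp (2 * δ * s) * ‖u s‖ ^ 2 :=
      antitone_of_deriv_nonpos (fun s => (hg s).differentiableAt) fun s => by
        rw [(hg s).deriv]
        have h1 := hQ' (u s)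
        rw [← realCLM_apply] at h1
        have h2 := Real.exp_pos (2 * δ * s)
        nlinarith
    have h := hanti ht
    have hu0 : u 0 = realCLM T v := by simp [hu]
    simp only [mul_zero, Real.exp_zero, one_mul, hu0] at h
    refine (sq_le_sq₀ (norm_nonneg _) (by positivity)).1 ?_
    have he : Real.exp (-δ * t) ^ 2 * Real.exp (2 * δ * t) = 1 := by
      rw [← Real.exp_nat_mul, ← Real.exp_add]
      simp; ring
    calc ‖u t‖ ^ 2 = Real.exp (-δ * t) ^ 2 * (Real.exp (2 * δ * t) * ‖u t‖ ^ 2) := by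
          rw [← mul_assoc, he, one_mul]
      _ ≤ Real.exp (-δ * t) ^ 2 * ‖realCLM T v‖ ^ 2 := by gcongr
      _ = _ := by ring
  rw [Matrix.l2_opNorm_def]
  refine ContinuousLinearMap.opNorm_le_bound _ (by positivity) fun v => ?_
  change ‖Matrix.toEuclideanLin (NormedSpace.exp ((t : ℂ) • Q)) v‖ ≤ _
  rw [realCLM_exp]
  have hinv : flow (realCLM Q) t v = realCLM T' (realCLM T (flow (realCLM Q) t v)) := by
    rw [← mul_apply_eq_comp, ← map_mul, hT, map_one]; rfl
  rw [hinv]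
  calc _ ≤ ‖T'‖ * ‖realCLM T (flow (realCLM Q) t v)‖ := norm_toEuclideanLin_le T' _
    _ ≤ ‖T'‖ * (Real.exp (-δ * t) * (‖T‖ * ‖v‖)) := by
        gcongr
        exact (hfl v).trans (by gcongr; exact norm_toEuclideanLin_le T v)
    _ = _ := by ring

end Dissipative

open scoped ComplexOrder in
lemma posSemidef_map_ofReal {n : ℕ} {N : Matrix (Fin n) (Fin n) ℝ} (hN : N.PosSemidef) :
    (N.map Complex.ofReal).PosSemidef := by
  open scoped MatrixOrder in
  obtain ⟨K, rfl⟩ := CStarAlgebra.nonneg_iff_eq_star_mul_self.mp hN.nonneg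
  have h : (star K * K).map Complex.ofReal = (K.map Complex.ofReal)ᴴ * K.map Complex.ofReal := by
    have : (star K).map Complex.ofReal = (K.map Complex.ofReal)ᴴ := by
      ext i j; simp [Matrix.star_apply]
    rw [← this]
    exact Matrix.map_mul (f := Complex.ofRealHom)
  rw [h]
  exact Matrix.posSemidef_conjTranspose_mul_self _

lemma inner_toEuclideanLin {ι : Type*} [Fintype ι] [DecidableEq ι] (Q : Matrix ι ι ℂ)
    (w : EuclideanSpace ℂ ι) :
    inner ℂ w (Matrix.toEuclideanLin Q w) = star w.ofLp ⬝ᵥ Q *ᵥ w.ofLp := by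
  rw [EuclideanSpace.inner_eq_star_dotProduct, dotProduct_comm]; rfl

open scoped ComplexOrder in
/-- The Riccati inequality in the coordinates in which `P` is the identity. -/
lemma exists_riccati_coordinates {n m : ℕ} (A : Matrix (Fin n) (Fin n) ℝ)
    (B : Matrix (Fin n) (Fin m) ℝ) {alpha : ℝ} {P : Matrix (Fin n) (Fin n) ℝ} (hP : P.PosDef)
    (hLMI : (-(P * A + Aᵀ * P - (2 : ℝ) • (P * B * Bᵀ * P) + (2 * alpha) • P)).PosDef) :
    ∃ C C' A' G : Matrix (Fin n) (Fin n) ℂ, C' * C = 1 ∧ C * A.map Complex.ofReal = A' * C ∧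
      C * (B * -(Bᵀ * P)).map Complex.ofReal = -(G * C) ∧ G.PosSemidef ∧
      ∀ w : EuclideanSpace ℂ (Fin n), (inner ℂ w (Matrix.toEuclideanLin A' w)).re ≤
        (inner ℂ w (Matrix.toEuclideanLin G w)).re - alpha * ‖w‖ ^ 2 := by
  open scoped MatrixOrder in
  -- The factor in `P = Cᵀ C` is the coordinate change that turns `P` into the identity.
  obtain ⟨C, hC⟩ := CStarAlgebra.nonneg_iff_eq_star_mul_self.mp hP.posSemidef.nonneg
  rw [Matrix.star_eq_conjTranspose, Matrix.conjTranspose_eq_transpose_of_trivial] at hC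
  have hCu : IsUnit C.det := by
    have h := (Matrix.isUnit_iff_isUnit_det _).1 hP.isUnit
    rw [hC, Matrix.det_mul] at h
    exact isUnit_of_mul_isUnit_right h
  have hCC := Matrix.mul_nonsing_inv C hCu
  have hCC' := Matrix.nonsing_inv_mul C hCu
  have hCt : C⁻¹ᵀ * Cᵀ = 1 := by rw [← Matrix.transpose_mul, hCC, Matrix.transpose_one]
  set N := C⁻¹ᵀ * (-(P * A + Aᵀ * P - (2 : ℝ) • (P * B * Bᵀ * P) + (2 * alpha) • P)) * C⁻¹ with hN
  have hNpsd : N.PosSemidef := by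
    have := hLMI.posSemidef.conjTranspose_mul_mul_same C⁻¹
    rwa [Matrix.conjTranspose_eq_transpose_of_trivial] at this
  set D := C * B with hD
  set A' := C * A * C⁻¹ with hA'
  have hCPC : C⁻¹ᵀ * P = C := by rw [hC, ← Matrix.mul_assoc, hCt, Matrix.one_mul]
  have hPC : P * C⁻¹ = Cᵀ := by rw [hC, Matrix.mul_assoc, hCC, Matrix.mul_one]
  -- Congruence by `C⁻¹` turns the matrix inequality into `A' + A'ᵀ ≤ 2 D Dᵀ - 2α`, so `G = D Dᵀ`.
  have hNeq : N = (2 : ℝ) • (D * Dᵀ) - A' - A'ᵀ - (2 * alpha) • 1 := by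
    have e1 : C⁻¹ᵀ * (P * A) * C⁻¹ = A' := by rw [← Matrix.mul_assoc, hCPC]
    have e2 : C⁻¹ᵀ * (Aᵀ * P) * C⁻¹ = A'ᵀ := by
      rw [hA', Matrix.transpose_mul, Matrix.transpose_mul, Matrix.mul_assoc, Matrix.mul_assoc Aᵀ,
        hPC]
    have e3 : C⁻¹ᵀ * (P * B * Bᵀ * P) * C⁻¹ = D * Dᵀ := by
      rw [hD, Matrix.transpose_mul, Matrix.mul_assoc, Matrix.mul_assoc _ P, hPC,
        Matrix.mul_assoc P B, Matrix.mul_assoc P, ← Matrix.mul_assoc _ P, hCPC]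
      simp only [Matrix.mul_assoc]
    have e4 : C⁻¹ᵀ * P * C⁻¹ = 1 := by rw [hCPC, hCC]
    rw [hN]
    simp only [Matrix.mul_neg, Matrix.neg_mul, Matrix.mul_add, Matrix.add_mul, Matrix.mul_sub,
      Matrix.sub_mul, Matrix.mul_smul, Matrix.smul_mul, e1, e2, e3, e4]
    abel
  have hmul : ∀ {p q r : ℕ} (X : Matrix (Fin p) (Fin q) ℝ) (Y : Matrix (Fin q) (Fin r) ℝ),
      (X * Y).map Complex.ofReal = X.map Complex.ofReal * Y.map Complex.ofReal :=
    fun X Y => Matrix.map_mul (f := Complex.ofRealHom)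
  have hone : (1 : Matrix (Fin n) (Fin n) ℝ).map Complex.ofReal = 1 :=
    Matrix.map_one _ Complex.ofReal_zero Complex.ofReal_one
  have hG : (D * Dᵀ).PosSemidef := by
    simpa using Matrix.posSemidef_self_mul_conjTranspose D
  refine ⟨C.map Complex.ofReal, C⁻¹.map Complex.ofReal, A'.map Complex.ofReal,
    (D * Dᵀ).map Complex.ofReal, by rw [← hmul, hCC', hone], ?_, ?_, posSemidef_map_ofReal hG, ?_⟩
  · rw [← hmul, ← hmul, hA', Matrix.mul_assoc _ C⁻¹, hCC', Matrix.mul_one]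
  · rw [← hmul, ← hmul, hD, hC, Matrix.transpose_mul]
    have : C * (B * -(Bᵀ * (Cᵀ * C))) = -(C * B * (Bᵀ * Cᵀ) * C) := by
      simp only [Matrix.mul_neg, Matrix.mul_assoc]
    rw [this]
    ext i j; simp
  · intro w
    have h := (Complex.le_def.1
      ((posSemidef_map_ofReal hNpsd).dotProduct_mulVec_nonneg w.ofLp)).1
    have hmap : N.map Complex.ofReal = (2 : ℂ) • (D * Dᵀ).map Complex.ofReal -
        A'.map Complex.ofReal - (A'.map Complex.ofReal)ᴴ - ((2 * alpha : ℝ) : ℂ) • 1 := by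
      rw [hNeq, ← hone]
      ext i j
      simp [-Matrix.map_one]
    have hnorm : (star w.ofLp ⬝ᵥ w.ofLp).re = ‖w‖ ^ 2 := by
      rw [norm_sq_eq_re_inner (𝕜 := ℂ) w, EuclideanSpace.inner_eq_star_dotProduct, dotProduct_comm]
      rfl
    have hadj : (star w.ofLp ⬝ᵥ (A'.map Complex.ofReal)ᴴ *ᵥ w.ofLp).re =
        (star w.ofLp ⬝ᵥ A'.map Complex.ofReal *ᵥ w.ofLp).re := by
      rw [Matrix.dotProduct_mulVec, Matrix.vecMul_conjTranspose, star_star,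
        ← Complex.conj_re (star w.ofLp ⬝ᵥ _)]
      congr 1
      rw [← Complex.star_def, ← Matrix.star_dotProduct_star, star_star, dotProduct_comm]
    rw [inner_toEuclideanLin, inner_toEuclideanLin]
    simp only [hmap, Matrix.sub_mulVec, Matrix.smul_mulVec, Matrix.one_mulVec, dotProduct_sub,
      dotProduct_smul, Complex.sub_re, smul_eq_mul, Complex.ofReal_re, Complex.ofReal_im, hnorm, hadj,
      Complex.zero_re, Complex.mul_re, Complex.re_ofNat, Complex.im_ofNat, zero_mul, sub_zero] at h
    linarith

/-- A block of a stacked vector. -/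
noncomputable def block {ι ν : Type*} (w : EuclideanSpace ℂ (ι × ν)) (i : ι) :
    EuclideanSpace ℂ ν := WithLp.toLp 2 fun p => w (i, p)

lemma sum_norm_sq_block {ι ν : Type*} [Fintype ι] [Fintype ν] (w : EuclideanSpace ℂ (ι × ν)) :
    ∑ i, ‖block w i‖ ^ 2 = ‖w‖ ^ 2 := by
  simp only [EuclideanSpace.norm_sq_eq, Fintype.sum_prod_type, block]

lemma inner_kronecker {ι ν : Type*} [Fintype ι] [Fintype ν] [DecidableEq ι] [DecidableEq ν]
    (X : Matrix ι ι ℂ) (Y : Matrix ν ν ℂ) (w : EuclideanSpace ℂ (ι × ν)) :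
    inner ℂ w (Matrix.toEuclideanLin (X ⊗ₖ Y) w) =
      ∑ i, ∑ j, X i j * inner ℂ (block w i) (Matrix.toEuclideanLin Y (block w j)) := by
  simp only [PiLp.inner_apply, Fintype.sum_prod_type, Matrix.toLpLin_apply, Matrix.mulVec,
    dotProduct, Matrix.kroneckerMap_apply, block, Finset.mul_sum, RCLike.inner_apply,
    Finset.sum_mul]
  refine Finset.sum_congr rfl fun i _ => ?_
  rw [Finset.sum_comm]
  refine Finset.sum_congr rfl fun j _ => Finset.sum_congr rfl fun p _ =>
    Finset.sum_congr rfl fun q _ => by ring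

/-- Dissipativity of `I ⊗ A' - J ⊗ G` when the diagonal of `J` dominates. -/
lemma re_inner_kronecker_le {ι ν : Type*} [Fintype ι] [Fintype ν] [DecidableEq ι] [DecidableEq ν]
    {A' G : Matrix ν ν ℂ} {alpha : ℝ}
    (hGpos : ∀ v : EuclideanSpace ℂ ν, 0 ≤ (inner ℂ v (Matrix.toEuclideanLin G v)).re ∧
      (inner ℂ v (Matrix.toEuclideanLin G v)).im = 0)
    (hA' : ∀ v : EuclideanSpace ℂ ν, (inner ℂ v (Matrix.toEuclideanLin A' v)).re ≤
        (inner ℂ v (Matrix.toEuclideanLin G v)).re - alpha * ‖v‖ ^ 2)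
    {J : Matrix ι ι ℂ} {η : ℝ} (hdiag : ∀ i, 1 ≤ (J i i).re)
    (hoff : ∀ i j, i ≠ j → ‖J i j‖ ≤ η) (hη : 0 ≤ η)
    (hηG : η * ‖G‖ * Fintype.card ι ≤ alpha / 2) (w : EuclideanSpace ℂ (ι × ν)) :
    (inner ℂ w (Matrix.toEuclideanLin
      ((1 : Matrix ι ι ℂ) ⊗ₖ A' - J ⊗ₖ G) w)).re ≤ -(alpha / 2) * ‖w‖ ^ 2 := by
  set g : ι → ι → ℂ := fun i j => inner ℂ (block w i) (Matrix.toEuclideanLin G (block w j)) with hg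
  set a : ι → ℂ := fun i => inner ℂ (block w i) (Matrix.toEuclideanLin A' (block w i)) with ha
  have hgn : ∀ i j, ‖g i j‖ ≤ ‖G‖ * (‖block w i‖ * ‖block w j‖) := fun i j =>
    calc ‖g i j‖ ≤ ‖block w i‖ * ‖Matrix.toEuclideanLin G (block w j)‖ := norm_inner_le_norm _ _
      _ ≤ ‖block w i‖ * (‖G‖ * ‖block w j‖) := by gcongr; exact norm_toEuclideanLin_le _ _
      _ = _ := by ring
  -- The off-diagonal penalty is also subtracted for `i = j`, so that the penalties sum to a full
  -- square, which Cauchy–Schwarz bounds by `card ι * ‖w‖²`.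
  have hterm : ∀ i j, (if i = j then (g i i).re else 0) -
      η * ‖G‖ * (‖block w i‖ * ‖block w j‖) ≤ (J i j * g i j).re := by
    intro i j
    have hb : 0 ≤ η * ‖G‖ * (‖block w i‖ * ‖block w j‖) := by positivity
    split_ifs with hij
    · subst hij
      rw [Complex.mul_re, (hGpos (block w i)).2, mul_zero, sub_zero]
      nlinarith [hdiag i, (hGpos (block w i)).1]
    · have h1 := Complex.abs_re_le_norm (J i j * g i j)
      rw [norm_mul] at h1
      have h2 := mul_le_mul (hoff i j hij) (hgn i j) (norm_nonneg _) hη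
      linarith [neg_abs_le (J i j * g i j).re]
  have hsum := Finset.sum_le_sum fun i (_ : i ∈ Finset.univ) =>
    Finset.sum_le_sum fun j (_ : j ∈ Finset.univ) => hterm i j
  simp only [Finset.sum_sub_distrib, Finset.sum_ite_eq, Finset.mem_univ, if_true,
    ← Finset.mul_sum] at hsum
  rw [← Finset.sum_mul, ← sq] at hsum
  have hcs : (∑ i, ‖block w i‖) ^ 2 ≤ Fintype.card ι * ‖w‖ ^ 2 := by
    rw [← sum_norm_sq_block]
    exact sq_sum_le_card_mul_sum_sq
  have hA := Finset.sum_le_sum fun i (_ : i ∈ Finset.univ) => hA' (block w i)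
  rw [Finset.sum_sub_distrib, ← Finset.mul_sum, sum_norm_sq_block] at hA
  have h1 := mul_le_mul_of_nonneg_left hcs (mul_nonneg hη (norm_nonneg G))
  have h2 := mul_le_mul_of_nonneg_right hηG (sq_nonneg ‖w‖)
  have hexp : (inner ℂ w (Matrix.toEuclideanLin
      ((1 : Matrix ι ι ℂ) ⊗ₖ A' - J ⊗ₖ G) w)).re = ∑ i, (a i).re - ∑ i, ∑ j, (J i j * g i j).re := by
    rw [map_sub, LinearMap.sub_apply, inner_sub_right, inner_kronecker, inner_kronecker,
      Complex.sub_re]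
    simp [Matrix.one_apply, hg, ha, -Complex.mul_re]
  rw [hexp]
  linarith

namespace Network

variable {M n m : ℕ} {net : Network M n m} {S : Matrix (Fin (M + 1)) (Fin (M + 1)) ℂ}

-- The Kronecker product of a Jordan rescaling `D` and the Riccati coordinates `C` makes `Â`
-- dissipative with rate `α / 2`; half of `α` pays for the rescaled superdiagonal.
open scoped ComplexOrder in
theorem exists_decayBound (hgraph : HasSpanningTree net.graph)
    {alpha : ℝ} (halpha : 0 < alpha)
    {P : Matrix (Fin n) (Fin n) ℝ} (hP : P.PosDef)
    (hLMI : (-(P * net.A + net.Aᵀ * P - (2 : ℝ) • (P * net.B * net.Bᵀ * P)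
      + (2 * alpha) • P)).PosDef)
    (hF : net.F = -(net.Bᵀ * P))
    (hc : ∀ μ ∈ spectrum ℂ net.laplacianC, μ ≠ 0 → 1 / μ.re ≤ net.c)
    (hS : net.IsJordanTransform S) :
    ∃ betaHat lamHat : ℝ, 0 < betaHat ∧ 0 < lamHat ∧ net.DecayBound S betaHat lamHat := by
  obtain ⟨C, C', A', G, hC, hCA, hCB, hG, hdis⟩ := exists_riccati_coordinates net.A net.B hP hLMI
  obtain ⟨η, hη, hηG⟩ : ∃ η : ℝ, 0 < η ∧ |net.c| * η * ‖G‖ * Fintype.card (Fin M) ≤ alpha / 2 := by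
    -- The `+ 1` keeps the denominator positive when `|c| ‖G‖ M = 0`.
    refine ⟨alpha / 2 / (|net.c| * ‖G‖ * M + 1), by positivity, ?_⟩
    rw [Fintype.card_fin]
    have h : 0 < |net.c| * ‖G‖ * M + 1 := by positivity
    calc _ = alpha / 2 * ((|net.c| * ‖G‖ * M) / (|net.c| * ‖G‖ * M + 1)) := by field_simp
      _ ≤ alpha / 2 * 1 := by gcongr; exact (div_le_one h).2 (by linarith)
      _ = _ := mul_one _
  have hηC : (η : ℂ) ≠ 0 := by exact_mod_cast hη.ne'
  -- Conjugation by powers of `η` fixes the diagonal and multiplies the superdiagonal by `η`.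
  set D : Matrix (Fin M) (Fin M) ℂ := Matrix.diagonal fun i => ((η : ℂ) ^ (i : ℕ))⁻¹ with hD
  set D' : Matrix (Fin M) (Fin M) ℂ := Matrix.diagonal fun i => (η : ℂ) ^ (i : ℕ) with hD'
  have hDD : D' * D = 1 := by
    rw [hD, hD', Matrix.diagonal_mul_diagonal, ← Matrix.diagonal_one]
    congr 1; ext i
    exact mul_inv_cancel₀ (pow_ne_zero _ hηC)
  set K : Matrix (Fin M) (Fin M) ℂ := D * ((net.c : ℂ) • net.J S) * D' with hK
  have hKe : ∀ i j, K i j = ((η : ℂ) ^ (i : ℕ))⁻¹ * (net.c * net.J S i j) * (η : ℂ) ^ (j : ℕ) := by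
    intro i j
    rw [hK, hD, hD', Matrix.mul_diagonal, Matrix.diagonal_mul, Matrix.smul_apply, smul_eq_mul]
  refine ⟨‖D' ⊗ₖ C'‖ * ‖D ⊗ₖ C‖ + 1, alpha / 2, by positivity, by positivity, fun t ht => ?_⟩
  refine (norm_exp_le_of_dissipative (T := D ⊗ₖ C) (T' := D' ⊗ₖ C')
    (Q' := (1 : Matrix (Fin M) (Fin M) ℂ) ⊗ₖ A' - K ⊗ₖ G) ?_ ?_ (δ := alpha / 2)
    (re_inner_kronecker_le (η := |net.c| * η) ?_ hdis ?_ ?_ (by positivity) hηG) ht).trans ?_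
  · rw [← Matrix.mul_kronecker_mul, hDD, hC, Matrix.one_kronecker_one]
  · have hKD : K * D = D * ((net.c : ℂ) • net.J S) := by
      rw [hK, Matrix.mul_assoc _ D', hDD, Matrix.mul_one]
    rw [AHat, hF, Matrix.mul_add, Matrix.sub_mul, ← Matrix.mul_kronecker_mul,
      ← Matrix.mul_kronecker_mul, ← Matrix.mul_kronecker_mul, ← Matrix.mul_kronecker_mul, hCA, hCB,
      hKD, Matrix.mul_one, Matrix.one_mul, sub_eq_add_neg]
    congr 1
    ext p q; simp [Matrix.kroneckerMap_apply]
  · intro v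
    rw [inner_toEuclideanLin]
    have := Complex.le_def.1 (hG.dotProduct_mulVec_nonneg v.ofLp)
    exact ⟨this.1, this.2.symm⟩
  · intro i
    rw [hKe, mul_right_comm, inv_mul_cancel₀ (pow_ne_zero _ hηC), one_mul, Complex.re_ofReal_mul]
    exact one_le_gain_mul_re hgraph hS hc i
  · intro i j hij
    have hij' := Fin.val_ne_of_ne hij
    rw [hKe]
    by_cases hj : (j : ℕ) = i + 1
    · rw [hj, pow_succ]
      have hJ : ‖net.J S i j‖ ≤ 1 := by
        rcases hS.2.1.2 i.succ j.succ (by simp [hj]) with h | ⟨h, -⟩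
        · change ‖(S⁻¹ * net.laplacianC * S) i.succ j.succ‖ ≤ 1
          rw [h]; simp
        · change ‖(S⁻¹ * net.laplacianC * S) i.succ j.succ‖ ≤ 1
          rw [h]; simp
      have : ((η : ℂ) ^ (i : ℕ))⁻¹ * (net.c * net.J S i j) * ((η : ℂ) ^ (i : ℕ) * η) =
          net.c * η * net.J S i j := by
        field_simp
      rw [this, norm_mul, norm_mul, Complex.norm_real, Complex.norm_real, Real.norm_eq_abs,
        Real.norm_eq_abs, abs_of_pos hη]
      exact mul_le_of_le_one_right (by positivity) hJ
    · have : net.J S i j = 0 := hS.2.1.1 i.succ j.succ (by simpa using hij'.symm) (by simpa using hj)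
      rw [this]
      simp; positivity
  · gcongr
    linarith

end Network

/-! ### The closed loop in the coordinates `x̂_{2:N}`. -/

lemma kronecker_mulVec_apply {ι κ μ ν : Type*} [Fintype κ] [Fintype ν]
    (X : Matrix ι κ ℂ) (Y : Matrix μ ν ℂ) (Z : Matrix κ ν ℂ) (p : ι × μ) :
    ((X ⊗ₖ Y) *ᵥ fun q => Z q.1 q.2) p = (X * Z * Yᵀ) p.1 p.2 := by
  simp only [Matrix.mulVec, dotProduct, Matrix.kroneckerMap_apply, Fintype.sum_prod_type_right,
    Matrix.mul_apply, Matrix.transpose_apply, Finset.sum_mul]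
  exact Finset.sum_congr rfl fun j _ => Finset.sum_congr rfl fun i _ => by ring

/-- The agents' states as the rows of a complex matrix. -/
noncomputable def rows {M n : ℕ} (v : Fin (M + 1) → State n) :
    Matrix (Fin (M + 1)) (Fin n) ℂ := Matrix.of fun j q => (v j q : ℂ)

lemma xHatTail_apply {M n : ℕ} (S : Matrix (Fin (M + 1)) (Fin (M + 1)) ℂ)
    (v : Fin (M + 1) → State n) (p : Fin M × Fin n) :
    xHatTail S v p = (S⁻¹.submatrix Fin.succ id * rows v) p.1 p.2 := by
  simp [xHatTail, rows, Matrix.mul_apply]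

/-- `xHatTail` as a continuous real-linear map. -/
noncomputable def xHatTailCLM {M : ℕ} (n : ℕ) (S : Matrix (Fin (M + 1)) (Fin (M + 1)) ℂ) :
    (Fin (M + 1) → State n) →L[ℝ] EuclideanSpace ℂ (Fin M × Fin n) :=
  LinearMap.toContinuousLinearMap
    { toFun := xHatTail S
      map_add' := fun v w => by
        ext p; simp [xHatTail, mul_add, Finset.sum_add_distrib]
      map_smul' := fun r v => by
        ext p
        simp only [xHatTail, PiLp.smul_apply, Pi.smul_apply, RingHom.id_apply, smul_eq_mul,
          Complex.ofReal_mul, Complex.real_smul, Finset.mul_sum]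
        exact Finset.sum_congr rfl fun j _ => by ring }

lemma xHatTailCLM_apply {M n : ℕ} (S : Matrix (Fin (M + 1)) (Fin (M + 1)) ℂ)
    (v : Fin (M + 1) → State n) : xHatTailCLM n S v = xHatTail S v := rfl

namespace Network

variable {M n m : ℕ} (net : Network M n m)

/-- The Laplacian acting on the agents' states. -/
noncomputable def laplacianSum (v : Fin (M + 1) → State n) (i : Fin (M + 1)) : State n :=
  ∑ j, net.laplacian i j • v j

lemma laplacianSum_add (v w : Fin (M + 1) → State n) (i : Fin (M + 1)) :
    net.laplacianSum (v + w) i = net.laplacianSum v i + net.laplacianSum w i := by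
  simp [laplacianSum, Finset.sum_add_distrib]

lemma laplacianSum_apply (v : Fin (M + 1) → State n) (i : Fin (M + 1)) (q : Fin n) :
    net.laplacianSum v i q = (net.laplacian *ᵥ fun j => v j q) i := by
  simp [laplacianSum, Matrix.mulVec, dotProduct]

lemma rows_laplacianSum (v : Fin (M + 1) → State n) :
    rows (net.laplacianSum v) = net.laplacianC * rows v := by
  ext i q
  simp [rows, laplacianSum_apply, Matrix.mul_apply, Matrix.mulVec, dotProduct, laplacianC]

open Classical in
lemma mul_input (v : Fin (M + 1) → State n) (i : Fin (M + 1)) :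
    Matrix.toEuclideanLin net.B (net.input v i) =
      Matrix.toEuclideanLin net.cBF (net.laplacianSum v i) := by
  have h : ∑ j ∈ Finset.univ.filter (fun j => net.graph.Adj j i), (v i - v j) =
      net.laplacianSum v i := by
    ext q
    rw [laplacianSum_apply, laplacian_mulVec, Finset.sum_filter]
    simp only [WithLp.ofLp_sum, Finset.sum_apply, adjacency, Matrix.of_apply, ite_mul, one_mul,
      zero_mul]
    refine Finset.sum_congr rfl fun j _ => ?_
    split_ifs <;> simp
  have h' : net.input v i = net.c • Matrix.toEuclideanLin net.F (net.laplacianSum v i) := by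
    rw [← h, input]
  rw [h', map_smul, cBF, map_smul, LinearMap.smul_apply]
  congr 1
  simp [Matrix.toLpLin_apply, Matrix.mulVec_mulVec]

section Estimates

variable {net} {S : Matrix (Fin (M + 1)) (Fin (M + 1)) ℂ}

/-- The stacked vector of a family of states, over the complex numbers. -/
noncomputable def stackC (v : Fin (M + 1) → State n) :
    EuclideanSpace ℂ (Fin (M + 1) × Fin n) := WithLp.toLp 2 fun p => (v p.1 p.2 : ℂ)

lemma norm_stackC_le (v : Fin (M + 1) → State n) {b : ℝ} (hb : 0 ≤ b) (hv : ∀ i, ‖v i‖ ≤ b) :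
    ‖stackC v‖ ≤ Real.sqrt (M + 1 : ℕ) * b := by
  have h := norm_stack_le v hb hv
  rw [Fintype.card_fin, ← norm_complexify] at h
  exact h

/-- The closed loop in the coordinates `x̂_{2:N}`. -/
lemma xHatTail_closedLoop (hS : net.IsJordanTransform S) (x v : Fin (M + 1) → State n) :
    xHatTail S (fun i => Matrix.toEuclideanLin net.A (x i) +
        Matrix.toEuclideanLin net.B (net.input v i)) =
      Matrix.toEuclideanLin (net.AHat S) (xHatTail S x) +
        Matrix.toEuclideanLin (net.BHat S) (stackC (v - x)) := by
  have hrows : rows (fun i => Matrix.toEuclideanLin net.A (x i) +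
        Matrix.toEuclideanLin net.B (net.input v i)) =
      rows x * (net.A.map Complex.ofReal)ᵀ +
        (net.c : ℂ) • (net.laplacianC * rows v * ((net.B * net.F).map Complex.ofReal)ᵀ) := by
    rw [← rows_laplacianSum]
    simp_rw [mul_input]
    ext i q
    simp [rows, cBF, Matrix.toLpLin_apply, Matrix.mulVec, dotProduct, Matrix.mul_apply (M := Matrix.of _),
      Finset.mul_sum, mul_comm]
  have hx : (xHatTail S x).ofLp = fun p => (S⁻¹.submatrix Fin.succ id * rows x) p.1 p.2 :=
    funext fun p => xHatTail_apply S x p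
  have he : (stackC (v - x)).ofLp = fun p => (rows v - rows x) p.1 p.2 := by
    ext p; simp [stackC, rows]
  ext p
  rw [xHatTail_apply, hrows, PiLp.add_apply, Matrix.toLpLin_apply, Matrix.toLpLin_apply, hx, he,
    PiLp.toLp_apply, PiLp.toLp_apply, AHat, BHat, Matrix.add_mulVec, Pi.add_apply, kronecker_mulVec_apply, kronecker_mulVec_apply,
    kronecker_mulVec_apply, ← Matrix.add_apply, ← Matrix.add_apply]
  -- Since `S⁻¹_{2:N} L = J S⁻¹_{2:N}`, splitting `v = x + (v - x)` puts the first part into `Â` and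
  -- the second into `B̂`.
  have hL := inv_mul_laplacian_tail hS
  have hL' : (S⁻¹ * net.laplacianC).submatrix Fin.succ id =
      S⁻¹.submatrix Fin.succ id * net.laplacianC := by
    ext i j; simp [Matrix.mul_apply]
  rw [hL'] at hL
  refine congrFun (congrFun ?_ p.1) p.2
  rw [Matrix.mul_add, Matrix.mul_smul, ← Matrix.mul_assoc (S⁻¹.submatrix _ _) (_ * _),
    ← Matrix.mul_assoc (S⁻¹.submatrix _ _) net.laplacianC, hL]
  simp only [Matrix.one_mul, Matrix.smul_mul, Matrix.mul_sub, Matrix.sub_mul,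
    Matrix.mul_assoc]
  abel

/-- This is the factorization `L = Θ S⁻¹_{2:N}`, applied blockwise; it is the source of `‖Θ‖` in
`H₁` and `H₂`. -/
lemma norm_laplacianSum_le (hgraph : HasSpanningTree net.graph) (hS : net.IsJordanTransform S)
    (x : Fin (M + 1) → State n) (i : Fin (M + 1)) :
    ‖net.laplacianSum x i‖ ≤ ‖net.Theta S‖ * ‖xHatTail S x‖ := by
  rw [← norm_complexify]
  refine le_trans (le_of_eq ?_) ((norm_block_le _ i).trans
    (norm_blockAction_le (net.Theta S) (xHatTail S x)))
  congr 2
  ext q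
  have h := congrFun (congrFun (net.rows_laplacianSum x) i) q
  rw [laplacian_eq_theta_mul hgraph hS, Matrix.mul_assoc, Matrix.mul_apply] at h
  simpa [xHatTail_apply, rows] using h

lemma norm_laplacianSum_le' (v : Fin (M + 1) → State n) {b : ℝ} (hb : 0 ≤ b)
    (hv : ∀ i, ‖v i‖ ≤ b) (i : Fin (M + 1)) :
    ‖net.laplacianSum v i‖ ≤ ‖net.laplacian‖ * (Real.sqrt (M + 1 : ℕ) * b) := by
  have h := norm_stack_le v hb hv
  rw [Fintype.card_fin] at h
  refine le_trans (le_of_eq ?_) (((norm_block_le _ i).trans (norm_blockAction_le net.laplacian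
    (WithLp.toLp 2 fun p : Fin (M + 1) × Fin n => v p.1 p.2))).trans (by gcongr))
  congr 1
  ext q
  simp [laplacianSum]

end Estimates

/-- If `B Bᵀ P = 0`, then `B = 0`, and the controllability matrix has rank 0 instead of `n ≥ 1`. -/
lemma cBF_ne_zero (hn : 1 ≤ n) (hctrl : Controllable net.A net.B) (hc : 0 < net.c)
    {P : Matrix (Fin n) (Fin n) ℝ} (hP : P.PosDef) (hF : net.F = -(net.Bᵀ * P)) :
    net.cBF ≠ 0 := by
  intro h
  have h1 : net.B * net.Bᵀ = 0 := by
    have h2 := (smul_eq_zero.1 h).resolve_left hc.ne'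
    rw [hF, Matrix.mul_neg, neg_eq_zero, ← Matrix.mul_assoc] at h2
    have h3 := congrArg (· * P⁻¹) h2
    simpa [Matrix.mul_assoc, Matrix.mul_nonsing_inv P ((Matrix.isUnit_iff_isUnit_det P).1 hP.isUnit)]
      using h3
  have hB : net.B = 0 := by
    rw [← Matrix.conjTranspose_eq_transpose_of_trivial] at h1
    exact Matrix.self_mul_conjTranspose_eq_zero.1 h1
  rw [Controllable, hB] at hctrl
  have : (Matrix.of fun (i : Fin n) (p : Fin n × Fin m) =>
      (net.A ^ (p.1 : ℕ) * (0 : Matrix (Fin n) (Fin m) ℝ)) i p.2) = 0 := by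
    ext i p; simp
  rw [this, Matrix.rank_zero] at hctrl
  omega

end Network

/-! ### Positivity and bounds for the constants. -/

/-- The growth of the error between events, in terms of `H₃ = κ (h₁ + h₂)`. -/
lemma growth_le {h₁ h₂ X Z : ℝ} (hX : 1 ≤ X) (hZ : 1 ≤ Z) (h2 : 0 ≤ h₂) (h12 : 0 ≤ h₁ + h₂) :
    h₁ * (X - Z⁻¹) + h₂ * (X - 1) ≤ (h₁ + h₂) * (X * Z - 1) := by
  have hZ0 : 0 < Z := by linarith
  have hZi : 0 < Z⁻¹ := inv_pos.2 hZ0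
  have hZ1 : Z⁻¹ ≤ 1 := inv_le_one_of_one_le₀ hZ
  have key : (h₁ + h₂) * (X * Z - 1) - (h₁ * (X - Z⁻¹) + h₂ * (X - 1)) =
      (Z - 1) * ((h₁ + h₂) * (X - Z⁻¹) + h₂ * Z⁻¹) := by
    field_simp; ring
  have : 0 ≤ (Z - 1) * ((h₁ + h₂) * (X - Z⁻¹) + h₂ * Z⁻¹) := by
    have h3 : 0 ≤ (h₁ + h₂) * (X - Z⁻¹) := mul_nonneg h12 (by linarith)
    have h4 : 0 ≤ h₂ * Z⁻¹ := by positivity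
    exact mul_nonneg (by linarith) (by linarith)
  linarith

namespace Network

variable {M n m : ℕ} {net : Network M n m} {S : Matrix (Fin (M + 1)) (Fin (M + 1)) ℂ}
  {x₀ : Fin (M + 1) → State n} {bet gam lam betaHat lamHat : ℝ}

lemma gainQ_nonneg (hgam : 0 ≤ gam) (hbH : 0 ≤ betaHat) (hlt : lam < lamHat) :
    0 ≤ net.gainQ S gam lam betaHat lamHat :=
  div_nonneg (by positivity) (sub_pos.2 hlt).le

lemma H₂_nonneg (hgam : 0 ≤ gam) (hbH : 0 ≤ betaHat) (hlt : lam < lamHat) :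
    0 ≤ net.H₂ S gam lam betaHat lamHat := by
  have := gainQ_nonneg (net := net) (S := S) hgam hbH hlt
  unfold H₂; positivity

/-- `H₁` may be negative, but its negative part is at most `‖Θ‖ q`, with `q` the value of `gainQ`.
It carries the smaller weight and is absorbed by the same term in `H₂`; the part `‖L‖ √N γ` remains.
-/
lemma H₃_pos (hL : net.laplacian ≠ 0) (hcBF : net.cBF ≠ 0) (hgam : 0 < gam) (hbH : 0 < betaHat)
    (hlam : 0 < lam) (hlt : lam < lamHat) {s : ℝ} (hs : 0 ≤ s) :
    0 < net.H₃ S x₀ gam lam betaHat lamHat s := by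
  have hq := gainQ_nonneg (net := net) (S := S) hgam.le hbH.le hlt
  have hκ : 0 < ‖net.cBF‖ := norm_pos_iff.2 hcBF
  have hℓ : 0 < ‖net.laplacian‖ * Real.sqrt (M + 1 : ℕ) * gam := by
    have := norm_pos_iff.2 hL
    positivity
  have hD : Real.exp ((lam - lamHat) * s) ≤ 1 :=
    Real.exp_le_one_iff.2 (mul_nonpos_of_nonpos_of_nonneg (by linarith) hs)
  have hA := norm_nonneg net.A
  refine mul_pos hκ ?_
  set q := net.gainQ S gam lam betaHat lamHat
  set D := Real.exp ((lam - lamHat) * s) with hDdef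
  have hDpos : 0 < D := Real.exp_pos _
  have h1 : -(‖net.Theta S‖ * q) / (‖net.A‖ + lam) ≤
      net.H₁ S x₀ gam lam betaHat lamHat * D / (‖net.A‖ + lamHat) := by
    have hθq : 0 ≤ ‖net.Theta S‖ * q := by positivity
    calc -(‖net.Theta S‖ * q) / (‖net.A‖ + lam) = -(‖net.Theta S‖ * q / (‖net.A‖ + lam)) := neg_div _ _
      _ ≤ -(‖net.Theta S‖ * q * D / (‖net.A‖ + lamHat)) := by
          refine neg_le_neg (div_le_div₀ hθq ?_ (by linarith) (by linarith))
          exact mul_le_of_le_one_right hθq hD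
      _ = (-(‖net.Theta S‖ * q)) * D / (‖net.A‖ + lamHat) := by ring
      _ ≤ _ := by
          have h0 : -(‖net.Theta S‖ * q) ≤ net.H₁ S x₀ gam lam betaHat lamHat := by
            have : 0 ≤ ‖net.Theta S‖ * (betaHat * ‖xHatTail S x₀‖) := by positivity
            unfold H₁
            rw [mul_sub]
            linarith
          have : 0 < ‖net.A‖ + lamHat := by linarith
          gcongr
  have h2 : net.H₂ S gam lam betaHat lamHat / (‖net.A‖ + lam) =
      ‖net.Theta S‖ * q / (‖net.A‖ + lam) +
        ‖net.laplacian‖ * Real.sqrt (M + 1 : ℕ) * gam / (‖net.A‖ + lam) := add_div _ _ _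
  have h3 : 0 < ‖net.laplacian‖ * Real.sqrt (M + 1 : ℕ) * gam / (‖net.A‖ + lam) :=
    div_pos hℓ (by linarith)
  rw [h2]
  rw [neg_div] at h1
  linarith

lemma exists_H₃_le (hlam : 0 < lam) (hlt : lam < lamHat) :
    ∃ K, ∀ s, 0 ≤ s → net.H₃ S x₀ gam lam betaHat lamHat s ≤ K := by
  refine ⟨‖net.cBF‖ * (|net.H₁ S x₀ gam lam betaHat lamHat| / (‖net.A‖ + lamHat) +
    net.H₂ S gam lam betaHat lamHat / (‖net.A‖ + lam)), fun s hs => ?_⟩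
  have hA := norm_nonneg net.A
  have hAl : 0 < ‖net.A‖ + lamHat := by linarith
  unfold H₃
  gcongr
  have hD : Real.exp ((lam - lamHat) * s) ≤ 1 :=
    Real.exp_le_one_iff.2 (mul_nonpos_of_nonpos_of_nonneg (by linarith) hs)
  calc _ ≤ |net.H₁ S x₀ gam lam betaHat lamHat| * Real.exp ((lam - lamHat) * s) := by
        gcongr; exact le_abs_self _
    _ ≤ _ := mul_le_of_le_one_right (abs_nonneg _) hD

/-- The quotient `(γ + h) / (β + h)` decreases in `h`, so its value at an upper bound of `H₃` works
for all `s`. -/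
lemma exists_epsAt_ge (hH₃ : ∀ s, 0 ≤ s → 0 < net.H₃ S x₀ gam lam betaHat lamHat s)
    (hbet : 0 < bet) (hgam : bet < gam) (hlam : 0 < lam) (hlt : lam < lamHat) :
    ∃ e > 0, ∀ s, 0 ≤ s → e ≤ net.epsAt S x₀ bet gam lam betaHat lamHat s := by
  obtain ⟨K, hK⟩ := exists_H₃_le (net := net) (S := S) (x₀ := x₀) (gam := gam)
    (betaHat := betaHat) hlam hlt
  have hAl : 0 < ‖net.A‖ + lamHat := by linarith [norm_nonneg net.A]
  have hK0 : 0 < K := (hH₃ 0 le_rfl).trans_le (hK 0 le_rfl)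
  refine ⟨Real.log ((gam + K) / (bet + K)) / (‖net.A‖ + lamHat), ?_, fun s hs => ?_⟩
  · exact div_pos (Real.log_pos ((one_lt_div (by linarith)).2 (by linarith))) hAl
  · have h0 := hH₃ s hs
    unfold epsAt
    refine div_le_div_of_nonneg_right (Real.log_le_log (div_pos (by linarith) (by linarith)) ?_)
      hAl.le
    rw [div_le_div_iff₀ (by linarith) (by linarith)]
    nlinarith [hK s hs]

lemma exists_tauAt_ge (hH₃ : ∀ s, 0 ≤ s → 0 < net.H₃ S x₀ gam lam betaHat lamHat s)
    (hbet : 0 < bet) (hlam : 0 < lam) (hlt : lam < lamHat) :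
    ∃ e > 0, ∀ s, 0 ≤ s → e ≤ net.tauAt S x₀ bet gam lam betaHat lamHat s := by
  obtain ⟨K, hK⟩ := exists_H₃_le (net := net) (S := S) (x₀ := x₀) (gam := gam)
    (betaHat := betaHat) hlam hlt
  have hAl : 0 < ‖net.A‖ + lamHat := by linarith [norm_nonneg net.A]
  have hK0 : 0 < K := (hH₃ 0 le_rfl).trans_le (hK 0 le_rfl)
  have hβK : 0 < bet / K := by positivity
  refine ⟨Real.log (1 + bet / K) / (‖net.A‖ + lamHat), ?_, fun s hs => ?_⟩
  · exact div_pos (Real.log_pos (by linarith)) hAl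
  · have h0 := hH₃ s hs
    unfold tauAt
    refine div_le_div_of_nonneg_right (Real.log_le_log (by linarith) ?_) hAl.le
    have := hK s hs
    gcongr

end Network

lemma exists_isGLB_image_of_le {f : ℝ → ℝ} (h : ∃ e > 0, ∀ s, 0 ≤ s → e ≤ f s) :
    ∃ e > 0, IsGLB (f '' Ici 0) e := by
  obtain ⟨e, he, hle⟩ := h
  have hb : e ∈ lowerBounds (f '' Ici 0) := by
    rintro _ ⟨s, hs, rfl⟩; exact hle s hs
  have hg := isGLB_csInf (s := f '' Ici 0) (nonempty_Ici.image f) ⟨e, hb⟩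
  exact ⟨_, he.trans_le (hg.2 hb), hg⟩

/-! ### Runs: event windows and explicit model states. -/

/-- The flow of the agents' free dynamics `ẋ = A x`. -/
noncomputable abbrev agentFlow {n : ℕ} (A : Matrix (Fin n) (Fin n) ℝ) : ℝ → State n →L[ℝ] State n :=
  flow (Matrix.toEuclideanCLM (n := Fin n) (𝕜 := ℝ) A)

lemma norm_agentFlow_le {n : ℕ} (A : Matrix (Fin n) (Fin n) ℝ) {r : ℝ} (hr : 0 ≤ r)
    (v : State n) : ‖agentFlow A r v‖ ≤ Real.exp (‖A‖ * r) * ‖v‖ := by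
  have h := norm_flow_apply_le (Matrix.toEuclideanCLM (n := Fin n) (𝕜 := ℝ) A) hr v
  rwa [Matrix.l2_opNorm_toEuclideanCLM] at h

/-- A set that contains, with each point, the points shortly after it. -/
def RightOpen (U : Set ℝ) : Prop := ∀ r ∈ U, U ∈ 𝓝[≥] r

/-- Windows are closed on the left and open on the right, so derivatives within a window are right
derivatives, as flow uniqueness requires. -/
lemma rightOpen_window (a b c : EReal) :
    RightOpen {s : ℝ | a ≤ s ∧ (s : EReal) < b ∧ (s : EReal) < c} := by
  rintro r ⟨h1, h2, h3⟩
  have ho : ∀ b : EReal, (r : EReal) < b → ∀ᶠ s : ℝ in 𝓝[≥] r, (s : EReal) < b := fun b hb =>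
    nhdsWithin_le_nhds ((isOpen_Iio.preimage continuous_coe_real_ereal).mem_nhds hb)
  filter_upwards [ho b h2, ho c h3, self_mem_nhdsWithin] with s hs2 hs3 hs1
  exact ⟨h1.trans (EReal.coe_le_coe_iff.2 hs1), hs2, hs3⟩

lemma SolvesOn.eq_agentFlow {n : ℕ} {A : Matrix (Fin n) (Fin n) ℝ} {y : ℝ → State n} {U : Set ℝ}
    (hy : SolvesOn A y U) (hU : RightOpen U) {a s : ℝ} (has : a ≤ s) (hI : Icc a s ⊆ U) :
    y s = agentFlow A (s - a) (y a) :=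
  eq_flow _ has (fun r hr => (hy r (hI hr)).continuousWithinAt.mono hI) fun r hr =>
    (hy r (hI (Ico_subset_Icc_self hr))).mono_of_mem_nhdsWithin (hU r (hI (Ico_subset_Icc_self hr)))

lemma SolvesOn.continuousWithinAt_Ici {n : ℕ} {A : Matrix (Fin n) (Fin n) ℝ} {y : ℝ → State n}
    {U : Set ℝ} (hy : SolvesOn A y U) (hU : RightOpen U) {s : ℝ} (hs : s ∈ U) :
    ContinuousWithinAt y (Ici s) s :=
  (hy s hs).continuousWithinAt.mono_of_mem_nhdsWithin (hU s hs)

/-- The delayed models are accurate up to `gam * exp (-lam * s)` before time `r`. -/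
def ErrorBound {M n : ℕ} (x yd : Fin (M + 1) → ℝ → State n) (gam lam r : ℝ) : Prop :=
  ∀ s, 0 ≤ s → s < r → ∀ j, ‖yd j s - x j s‖ ≤ gam * Real.exp (-lam * s)

namespace IsRun

variable {M n m : ℕ} {net : Network M n m} {bet lam d : ℝ} {x y yd : Fin (M + 1) → ℝ → State n}
  {t : Fin (M + 1) → ℕ → EReal} {T : EReal}

lemma time_nonneg (h : IsRun net bet lam d x y yd t T) (i : Fin (M + 1)) (k : ℕ) : 0 ≤ t i k := by
  induction k with
  | zero => exact (h.event_zero i).ge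
  | succ k ih =>
    by_cases hk : t i k = ⊤
    · rw [h.event_top i k hk]; exact le_top
    · exact ih.trans (h.event_lt i k hk).le

lemma time_cases (h : IsRun net bet lam d x y yd t T) (i : Fin (M + 1)) (k : ℕ) :
    t i k = ⊤ ∨ ∃ a : ℝ, 0 ≤ a ∧ t i k = a := by
  have h0 := h.time_nonneg i k
  induction hk : t i k using EReal.rec with
  | bot => rw [hk] at h0; simp at h0
  | top => exact Or.inl rfl
  | coe a => rw [hk] at h0; exact Or.inr ⟨a, by exact_mod_cast h0, rfl⟩

/-- Every time before the horizon lies between two consecutive event times. -/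
lemma exists_window (h : IsRun net bet lam d x y yd t T) (i : Fin (M + 1)) {s : ℝ} (hs : 0 ≤ s)
    (hsT : (s : EReal) < T) :
    ∃ k, ∃ a : ℝ, 0 ≤ a ∧ t i k = a ∧ a ≤ s ∧ (s : EReal) < t i (k + 1) := by
  classical
  have hsup : (s : EReal) < ⨆ k, t i k := by
    rw [h.horizon] at hsT
    exact hsT.trans_le (iInf_le _ i)
  -- The first event time beyond `s` closes the window.
  have hex := lt_iSup_iff.1 hsup
  have hfind := Nat.find_spec hex
  obtain ⟨k, hk⟩ : ∃ k, Nat.find hex = k + 1 := by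
    refine Nat.exists_eq_succ_of_ne_zero fun h0 => ?_
    rw [h0, h.event_zero] at hfind
    exact absurd hfind (not_lt.2 (by exact_mod_cast hs))
  have hle : t i k ≤ s := not_lt.1 (Nat.find_min hex (by omega))
  rcases h.time_cases i k with ht | ⟨a, ha0, ha⟩
  · rw [ht] at hle; exact absurd hle (by simp)
  · exact ⟨k, a, ha0, ha, by rw [ha] at hle; exact_mod_cast hle, hk ▸ hfind⟩

lemma y_eq (h : IsRun net bet lam d x y yd t T) {i : Fin (M + 1)} {k : ℕ} {a s : ℝ}
    (ha : t i k = a) (has : a ≤ s) (hs : (s : EReal) < t i (k + 1)) (hsT : (s : EReal) < T) :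
    y i s = agentFlow net.A (s - a) (x i a) := by
  rw [← h.y_reset i k a ha]
  refine (h.y_deriv i k).eq_agentFlow (rightOpen_window _ _ _) has fun r hr => ?_
  have hrs : (r : EReal) ≤ s := EReal.coe_le_coe_iff.2 hr.2
  exact ⟨by rw [ha]; exact_mod_cast hr.1, hrs.trans_lt hs, hrs.trans_lt hsT⟩

/-- The factor `exp (A d)` in the update compensates the delay: the delayed model runs on the free
motion that started at the event. -/
lemma yd_eq (h : IsRun net bet lam d x y yd t T) {i : Fin (M + 1)} {k : ℕ} {a s : ℝ}
    (ha : t i k = a) (has : a + d ≤ s) (hs : (s : EReal) < t i (k + 1) + (d : EReal))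
    (hsT : (s : EReal) < T) :
    yd i s = agentFlow net.A (s - a) (x i a) := by
  have hadT : ((a + d : ℝ) : EReal) < T := (EReal.coe_le_coe_iff.2 has).trans_lt hsT
  have h1 := (h.yd_deriv i k).eq_agentFlow (rightOpen_window _ _ _) has fun r hr => by
    have hrs : (r : EReal) ≤ s := EReal.coe_le_coe_iff.2 hr.2
    exact ⟨by rw [ha]; exact_mod_cast hr.1, hrs.trans_lt hs, hrs.trans_lt hsT⟩
  rw [h1, h.yd_update i k a ha hadT, toEuclideanCLM_exp, ← flow_add_apply]
  congr 2; ring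

lemma yd_init_eq (h : IsRun net bet lam d x y yd t T) {i : Fin (M + 1)} {s : ℝ} (hs0 : 0 ≤ s)
    (hs : s < d) (hsT : (s : EReal) < T) : yd i s = agentFlow net.A s (yd i 0) := by
  have hU := rightOpen_window 0 d T
  have h1 : SolvesOn net.A (yd i)
      {s : ℝ | (0 : EReal) ≤ s ∧ (s : EReal) < d ∧ (s : EReal) < T} := by
    simpa using h.yd_init_deriv i
  have := h1.eq_agentFlow hU hs0 fun r hr => by
    have hrs : (r : EReal) ≤ s := EReal.coe_le_coe_iff.2 hr.2
    exact ⟨by exact_mod_cast hr.1, hrs.trans_lt (by exact_mod_cast hs), hrs.trans_lt hsT⟩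
  simpa using this

/-- Every time before the horizon lies in the initial phase or in a delayed window. -/
lemma exists_delayed_window (h : IsRun net bet lam d x y yd t T) (i : Fin (M + 1)) (hd : 0 ≤ d)
    {s : ℝ} (hsT : (s : EReal) < T) (hds : d ≤ s) :
    ∃ k, ∃ a : ℝ, 0 ≤ a ∧ t i k = a ∧ a + d ≤ s ∧ (s : EReal) < t i (k + 1) + (d : EReal) := by
  obtain ⟨k, a, ha0, ha, has, hs⟩ := h.exists_window i (s := s - d) (by linarith)
    ((EReal.coe_le_coe_iff.2 (by linarith)).trans_lt hsT)
  refine ⟨k, a, ha0, ha, by linarith, ?_⟩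
  rcases h.time_cases i (k + 1) with ht | ⟨b, -, hb⟩
  · rw [ht, EReal.top_add_coe]; exact EReal.coe_lt_top s
  · rw [hb] at hs ⊢
    have : s - d < b := by exact_mod_cast hs
    exact_mod_cast (by linarith : s < b + d)

lemma yd_continuousWithinAt (h : IsRun net bet lam d x y yd t T) (i : Fin (M + 1)) (hd : 0 ≤ d)
    {s : ℝ} (hs : 0 ≤ s) (hsT : (s : EReal) < T) : ContinuousWithinAt (yd i) (Ici s) s := by
  rcases lt_or_ge s d with hsd | hds
  · have h1 : SolvesOn net.A (yd i)
        {s : ℝ | (0 : EReal) ≤ s ∧ (s : EReal) < d ∧ (s : EReal) < T} := by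
      simpa using h.yd_init_deriv i
    exact h1.continuousWithinAt_Ici (rightOpen_window _ _ _)
      ⟨by exact_mod_cast hs, by exact_mod_cast hsd, hsT⟩
  · obtain ⟨k, a, -, ha, h1, h2⟩ := h.exists_delayed_window i hd hsT hds
    exact (h.yd_deriv i k).continuousWithinAt_Ici (rightOpen_window _ _ _)
      ⟨by rw [ha]; exact_mod_cast h1, h2, hsT⟩

lemma x_continuousOn (h : IsRun net bet lam d x y yd t T) (i : Fin (M + 1)) {a r : ℝ} (ha : 0 ≤ a)
    (hr : (r : EReal) < T) : ContinuousOn (x i) (Icc a r) :=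
  (h.x_cont i).mono fun _ hs =>
    ⟨ha.trans hs.1, (EReal.coe_le_coe_iff.2 hs.2).trans_lt hr⟩

/-! ### State and input estimates under the error bound. -/

section Estimates

variable {S : Matrix (Fin (M + 1)) (Fin (M + 1)) ℂ} {x₀ : Fin (M + 1) → State n}
  {gam betaHat lamHat : ℝ}

/-- Variation of constants for `Â`: the first term is the free response, the second the convolution
of `e^{-λ̂s}` with `e^{-λs}`, whose factor `1 / (λ̂ - λ)` sits in `gainQ`. -/
lemma norm_xHatTail_le (h : IsRun net bet lam d x y yd t T) (hx₀ : ∀ i, x i 0 = x₀ i)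
    (hS : net.IsJordanTransform S) (hdec : net.DecayBound S betaHat lamHat) (hbH : 0 < betaHat)
    (hgam : 0 < gam) (hlt : lam < lamHat) {r : ℝ} (hr : 0 ≤ r) (hrT : (r : EReal) < T)
    (herr : ErrorBound x yd gam lam r) :
    ‖xHatTail S (fun j => x j r)‖ ≤ betaHat * ‖xHatTail S x₀‖ * Real.exp (-lamHat * r) +
      net.gainQ S gam lam betaHat lamHat * (Real.exp (-lam * r) - Real.exp (-lamHat * r)) := by
  set q := net.gainQ S gam lam betaHat lamHat with hq
  have hqm : q * (lamHat - lam) = Real.sqrt (M + 1 : ℕ) * gam * betaHat * ‖net.BHat S‖ := by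
    rw [hq, Network.gainQ, div_mul_cancel₀ _ (sub_pos.2 hlt).ne']
  have hflow : ∀ s, 0 ≤ s → ∀ v, ‖flow (realCLM (net.AHat S)) s v‖ ≤
      betaHat * Real.exp (-lamHat * s) * ‖v‖ := fun s hs v => by
    rw [← realCLM_exp]
    exact (norm_toEuclideanLin_le _ _).trans (by gcongr; exact hdec s hs)
  have hcont : ContinuousOn (fun s => xHatTail S fun j => x j s) (Icc 0 r) :=
    (xHatTailCLM n S).continuous.comp_continuousOn
      (continuousOn_pi.2 fun j => h.x_continuousOn j le_rfl hrT)
  have hder : ∀ s ∈ Ico 0 r, HasDerivWithinAt (fun s => xHatTail S fun j => x j s)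
      (realCLM (net.AHat S) (xHatTail S fun j => x j s) +
        Matrix.toEuclideanLin (net.BHat S)
          (Network.stackC ((fun j => yd j s) - fun j => x j s))) (Ici s) s := by
    intro s hs
    have h1 := hasDerivWithinAt_pi.2 fun j => h.x_deriv j s hs.1
      ((EReal.coe_lt_coe_iff.2 hs.2).trans hrT)
    have h2 := (xHatTailCLM n S).hasFDerivAt.comp_hasDerivWithinAt s h1
    rw [xHatTailCLM_apply, Network.xHatTail_closedLoop hS] at h2
    exact h2
  have key := norm_sub_flow_le (realCLM (net.AHat S)) hr hcont hder
    (G := fun s => q * (Real.exp (-lamHat * r) * Real.exp ((lamHat - lam) * s)))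
    (G' := fun s => q * (Real.exp (-lamHat * r) * (Real.exp ((lamHat - lam) * s) *
      (lamHat - lam)))) (fun s => by
        have := ((hasDerivAt_id s).const_mul (lamHat - lam)).exp
        simpa using (this.const_mul (Real.exp (-lamHat * r))).const_mul q)
    (fun s hs => by
      have hw : ‖Network.stackC ((fun j => yd j s) - fun j => x j s)‖ ≤
          Real.sqrt (M + 1 : ℕ) * (gam * Real.exp (-lam * s)) :=
        Network.norm_stackC_le _ (by positivity) fun j => herr s hs.1 hs.2 j
      calc _ ≤ betaHat * Real.exp (-lamHat * (r - s)) * (‖net.BHat S‖ *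
              (Real.sqrt (M + 1 : ℕ) * (gam * Real.exp (-lam * s)))) := by
            refine (hflow _ (by linarith [hs.2]) _).trans ?_
            gcongr
            exact (norm_toEuclideanLin_le _ _).trans (by gcongr)
        _ = q * (lamHat - lam) * (Real.exp (-lamHat * (r - s)) * Real.exp (-lam * s)) := by
            rw [hqm]; ring
        _ = q * (lamHat - lam) * (Real.exp (-lamHat * r) * Real.exp ((lamHat - lam) * s)) := by
            rw [← Real.exp_add, ← Real.exp_add]; ring_nf
        _ = _ := by ring)
  have h0 : (fun j => x j 0) = x₀ := funext hx₀
  have hfree := hflow r hr (xHatTail S x₀)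
  simp only [sub_zero, h0, mul_zero, Real.exp_zero, mul_one] at key
  rw [← Real.exp_add] at key
  have hexp : -lamHat * r + (lamHat - lam) * r = -lam * r := by ring
  rw [hexp] at key
  have := norm_le_norm_add_norm_sub' (xHatTail S fun j => x j r)
    (flow (realCLM (net.AHat S)) r (xHatTail S x₀))
  linarith

lemma norm_input_le (h : IsRun net bet lam d x y yd t T) (hx₀ : ∀ i, x i 0 = x₀ i)
    (hgraph : HasSpanningTree net.graph)
    (hS : net.IsJordanTransform S) (hdec : net.DecayBound S betaHat lamHat) (hbH : 0 < betaHat)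
    (hgam : 0 < gam) (hlt : lam < lamHat) {r : ℝ} (hr : 0 ≤ r) (hrT : (r : EReal) < T)
    (herr : ErrorBound x yd gam lam r)
    (herr' : ∀ j, ‖yd j r - x j r‖ ≤ gam * Real.exp (-lam * r)) (i : Fin (M + 1)) :
    ‖Matrix.toEuclideanLin net.B (net.input (fun j => yd j r) i)‖ ≤
      ‖net.cBF‖ * (net.H₁ S x₀ gam lam betaHat lamHat * Real.exp (-lamHat * r) +
        net.H₂ S gam lam betaHat lamHat * Real.exp (-lam * r)) := by
  rw [Network.mul_input]
  refine (norm_toEuclideanLin_le _ _).trans (mul_le_mul_of_nonneg_left ?_ (norm_nonneg _))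
  have hsplit : (fun j => yd j r) = (fun j => x j r) + fun j => yd j r - x j r := by
    ext j; simp
  rw [hsplit, Network.laplacianSum_add]
  have h1 := Network.norm_laplacianSum_le hgraph hS (fun j => x j r) i
  have h2 := Network.norm_laplacianSum_le' (net := net) (fun j => yd j r - x j r)
    (b := gam * Real.exp (-lam * r)) (by positivity) herr' i
  have h3 := mul_le_mul_of_nonneg_left
    (h.norm_xHatTail_le hx₀ hS hdec hbH hgam hlt hr hrT herr) (norm_nonneg (net.Theta S))
  refine (norm_add_le _ _).trans ((add_le_add (h1.trans h3) h2).trans (le_of_eq ?_))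
  unfold Network.H₁ Network.H₂
  ring

/-- Deviation of an agent from its free motion, in terms of `H₃`. -/
lemma norm_sub_agentFlow_le (h : IsRun net bet lam d x y yd t T) (hx₀ : ∀ i, x i 0 = x₀ i)
    (hgraph : HasSpanningTree net.graph)
    (hS : net.IsJordanTransform S) (hdec : net.DecayBound S betaHat lamHat) (hbH : 0 < betaHat)
    (hgam : 0 < gam) (hlam : 0 < lam) (hlt : lam < lamHat) {a r : ℝ} (ha : 0 ≤ a) (har : a ≤ r)
    (hH : 0 ≤ net.H₃ S x₀ gam lam betaHat lamHat a) (hcBF : net.cBF ≠ 0)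
    (hrT : (r : EReal) < T) (herr : ErrorBound x yd gam lam r) (i : Fin (M + 1)) :
    ‖x i r - agentFlow net.A (r - a) (x i a)‖ ≤ Real.exp (-lam * r) *
      (net.H₃ S x₀ gam lam betaHat lamHat a *
        (Real.exp ((‖net.A‖ + lamHat) * (r - a)) - 1)) := by
  set p := ‖net.A‖ with hp
  have hp0 : 0 ≤ p := norm_nonneg _
  set κ := ‖net.cBF‖ with hκ
  have hκ0 : 0 < κ := norm_pos_iff.2 hcBF
  set H₁ := net.H₁ S x₀ gam lam betaHat lamHat with hH₁
  set H₂ := net.H₂ S gam lam betaHat lamHat with hH₂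
  have hH₂0 : 0 ≤ H₂ := Network.H₂_nonneg hgam.le hbH.le hlt
  have hpL : 0 < p + lamHat := by linarith
  have hpl : 0 < p + lam := by linarith
  -- A primitive of the input bound times `e^{‖A‖(r-s)}`; its two rates produce the denominators in
  -- `H₃`.
  set G : ℝ → ℝ := fun s => -(κ * (Real.exp (p * r) *
    (H₁ / (p + lamHat) * Real.exp (-(p + lamHat) * s) +
      H₂ / (p + lam) * Real.exp (-(p + lam) * s)))) with hG
  have hGd : ∀ s, HasDerivAt G (Real.exp (p * (r - s)) *
      (κ * (H₁ * Real.exp (-lamHat * s) + H₂ * Real.exp (-lam * s)))) s := by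
    intro s
    have e1 := ((hasDerivAt_id s).const_mul (-(p + lamHat))).exp.const_mul (H₁ / (p + lamHat))
    have e2 := ((hasDerivAt_id s).const_mul (-(p + lam))).exp.const_mul (H₂ / (p + lam))
    refine ((((e1.add e2).const_mul (Real.exp (p * r))).const_mul κ).neg).congr_deriv ?_
    have x1 : Real.exp (-(p + lamHat) * s) = Real.exp (-p * s) * Real.exp (-lamHat * s) := by
      rw [← Real.exp_add]; ring_nf
    have x2 : Real.exp (-(p + lam) * s) = Real.exp (-p * s) * Real.exp (-lam * s) := by
      rw [← Real.exp_add]; ring_nf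
    have x3 : Real.exp (p * (r - s)) = Real.exp (p * r) * Real.exp (-p * s) := by
      rw [← Real.exp_add]; ring_nf
    simp only [id, x1, x2, x3]
    field_simp
    ring
  have key := norm_sub_flow_le (Matrix.toEuclideanCLM (n := Fin n) (𝕜 := ℝ) net.A) har
    (h.x_continuousOn i ha hrT)
    (w := fun s => Matrix.toEuclideanLin net.B (net.input (fun j => yd j s) i))
    (fun s hs => h.x_deriv i s (ha.trans hs.1) ((EReal.coe_lt_coe_iff.2 hs.2).trans hrT)) hGd
    (fun s hs => by
      refine (norm_agentFlow_le net.A (by linarith [hs.2]) _).trans ?_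
      gcongr
      have hs0 := ha.trans hs.1
      exact h.norm_input_le hx₀ hgraph hS hdec hbH hgam hlt hs0
        ((EReal.coe_lt_coe_iff.2 hs.2).trans hrT)
        (fun u hu0 hu => herr u hu0 (hu.trans hs.2)) (herr s hs0 hs.2) i)
  refine key.trans ?_
  -- After `e^{-λr}` is factored out, the rest depends on `a` through `D` and on `r - a` through `X`
  -- and `Z`, in the form treated by `growth_le`.
  set D := Real.exp ((lam - lamHat) * a) with hD
  set X := Real.exp ((p + lam) * (r - a)) with hX
  set Z := Real.exp ((lamHat - lam) * (r - a)) with hZ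
  have hX1 : 1 ≤ X := Real.one_le_exp (mul_nonneg hpl.le (by linarith))
  have hZ1 : 1 ≤ Z := Real.one_le_exp (mul_nonneg (by linarith) (by linarith))
  have hXZ : Real.exp ((p + lamHat) * (r - a)) = X * Z := by
    rw [hX, hZ, ← Real.exp_add]; ring_nf
  have hHeq : net.H₃ S x₀ gam lam betaHat lamHat a =
      κ * (H₁ * D / (p + lamHat) + H₂ / (p + lam)) := rfl
  have h12 : 0 ≤ H₁ * D / (p + lamHat) + H₂ / (p + lam) := by
    rw [hHeq] at hH
    exact nonneg_of_mul_nonneg_right hH hκ0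
  have hgrow := growth_le hX1 hZ1 (div_nonneg hH₂0 hpl.le) h12
  have hGeq : G r - G a = Real.exp (-lam * r) *
      (κ * (H₁ * D / (p + lamHat) * (X - Z⁻¹) + H₂ / (p + lam) * (X - 1))) := by
    have z : Z⁻¹ = Real.exp (-((lamHat - lam) * (r - a))) := (Real.exp_neg _).symm
    have y1 : Real.exp (p * r) * Real.exp (-(p + lamHat) * a) =
        Real.exp (-lam * r) * (D * X) := by
      rw [hD, hX, ← Real.exp_add, ← Real.exp_add, ← Real.exp_add]; ring_nf
    have y2 : Real.exp (p * r) * Real.exp (-(p + lamHat) * r) =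
        Real.exp (-lam * r) * (D * Z⁻¹) := by
      rw [hD, z, ← Real.exp_add, ← Real.exp_add, ← Real.exp_add]; ring_nf
    have y3 : Real.exp (p * r) * Real.exp (-(p + lam) * a) = Real.exp (-lam * r) * X := by
      rw [hX, ← Real.exp_add, ← Real.exp_add]; ring_nf
    have y4 : Real.exp (p * r) * Real.exp (-(p + lam) * r) = Real.exp (-lam * r) := by
      rw [← Real.exp_add]; ring_nf
    have : G r - G a = κ * (H₁ / (p + lamHat) *
        (Real.exp (p * r) * Real.exp (-(p + lamHat) * a) -
          Real.exp (p * r) * Real.exp (-(p + lamHat) * r)) +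
        H₂ / (p + lam) * (Real.exp (p * r) * Real.exp (-(p + lam) * a) -
          Real.exp (p * r) * Real.exp (-(p + lam) * r))) := by
      simp only [hG]; ring
    rw [this, y1, y2, y3, y4]
    ring
  rw [hGeq, hXZ, hHeq, mul_assoc κ]
  gcongr

end Estimates

end IsRun

/-! ### Continuation of the error bound, absence of Zeno behavior, consensus. -/

namespace IsRun

variable {M n m : ℕ} {net : Network M n m} {bet lam d : ℝ} {x y yd : Fin (M + 1) → ℝ → State n}
  {t : Fin (M + 1) → ℕ → EReal} {T : EReal}

/-- At an event, the free motion from the previous event has reached the threshold. -/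
lemma norm_at_event (h : IsRun net bet lam d x y yd t T) {i : Fin (M + 1)} {k : ℕ} {a b : ℝ}
    (ha : t i k = a) (hb : t i (k + 1) = b) :
    ‖agentFlow net.A (b - a) (x i a) - x i b‖ = bet * Real.exp (-lam * b) := by
  have ha0 : 0 ≤ a := by have := h.time_nonneg i k; rw [ha] at this; exact_mod_cast this
  have hab : a < b := by
    have := h.event_lt i k (by rw [ha]; simp)
    rw [ha, hb] at this
    exact_mod_cast this
  have hbT : (b : EReal) < T := hb ▸ h.event_horizon i (k + 1) (by rw [hb]; simp)
  have hmem : ∀ᶠ s in 𝓝[<] b, s ∈ Ico a b :=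
    Ico_mem_nhdsLT_of_mem (right_mem_Ioc.2 hab)
  have hx : Tendsto (x i) (𝓝[<] b) (𝓝 (x i b)) := by
    have h1 := h.x_continuousOn i ha0 hbT b (right_mem_Icc.2 hab.le)
    exact h1.tendsto.mono_left (le_inf nhdsWithin_le_nhds
      (le_principal_iff.2 (hmem.mono fun s hs => Ico_subset_Icc_self hs)))
  have hz : Tendsto (fun s => agentFlow net.A (s - a) (x i a)) (𝓝[<] b)
      (𝓝 (agentFlow net.A (b - a) (x i a))) :=
    (((continuous_flow_apply _ (x i a)).comp (continuous_id.sub continuous_const)).tendsto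
      b).mono_left nhdsWithin_le_nhds
  have hlim := (hz.sub hx).norm
  refine tendsto_nhds_unique (hlim.congr' ?_) (h.event i k b hb)
  filter_upwards [hmem] with s hs
  have hsb : (s : EReal) < b := EReal.coe_lt_coe_iff.2 hs.2
  rw [h.y_eq ha hs.1 (by rwa [hb]) (hsb.trans hbT)]

section Estimates

variable {S : Matrix (Fin (M + 1)) (Fin (M + 1)) ℂ} {x₀ : Fin (M + 1) → State n}
  {gam betaHat lamHat : ℝ}

/-- An error within the smaller threshold stays below the larger one for the admissible delay. -/
lemma norm_drift_lt (h : IsRun net bet lam d x y yd t T) (hx₀ : ∀ i, x i 0 = x₀ i)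
    (hgraph : HasSpanningTree net.graph)
    (hS : net.IsJordanTransform S) (hdec : net.DecayBound S betaHat lamHat) (hbH : 0 < betaHat)
    (hbet : 0 < bet) (hgam : 0 < gam) (hlam : 0 < lam) (hlt : lam < lamHat) (hcBF : net.cBF ≠ 0)
    {b r : ℝ} (hb : 0 ≤ b) (hbr : b ≤ r)
    (hH : 0 < net.H₃ S x₀ gam lam betaHat lamHat b)
    (heps : r - b < net.epsAt S x₀ bet gam lam betaHat lamHat b)
    (hrT : (r : EReal) < T) (herr : ErrorBound x yd gam lam r) {i : Fin (M + 1)} {v : State n}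
    (hv : ‖v - x i b‖ ≤ bet * Real.exp (-lam * b)) :
    ‖agentFlow net.A (r - b) v - x i r‖ < gam * Real.exp (-lam * r) := by
  have hdev := h.norm_sub_agentFlow_le hx₀ hgraph hS hdec hbH hgam hlam hlt hb hbr hH.le hcBF hrT
    herr i
  have hA := norm_nonneg net.A
  have hpL : 0 < ‖net.A‖ + lamHat := by linarith
  set H := net.H₃ S x₀ gam lam betaHat lamHat b
  set Y := Real.exp ((‖net.A‖ + lamHat) * (r - b)) with hY
  -- Equivalently `β Y + H (Y - 1) < γ`: amplified initial error plus departure from free motion.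
  -- This is where the formula for `ε` comes from.
  have hYlt : Y < (gam + H) / (bet + H) := by
    rw [Network.epsAt, lt_div_iff₀ hpL] at heps
    rw [← Real.exp_log (x := (gam + H) / (bet + H)) (by positivity)]
    exact Real.exp_lt_exp.2 (by linarith)
  rw [lt_div_iff₀ (by linarith)] at hYlt
  have hfree : ‖agentFlow net.A (r - b) (v - x i b)‖ ≤ Real.exp (-lam * r) * (bet * Y) :=
    calc _ ≤ Real.exp (‖net.A‖ * (r - b)) * (bet * Real.exp (-lam * b)) :=
          (norm_agentFlow_le _ (by linarith) _).trans (by gcongr)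
      _ = Real.exp (-lam * r) * (bet * Real.exp ((‖net.A‖ + lam) * (r - b))) := by
          have : Real.exp (‖net.A‖ * (r - b)) * Real.exp (-lam * b) =
              Real.exp (-lam * r) * Real.exp ((‖net.A‖ + lam) * (r - b)) := by
            rw [← Real.exp_add, ← Real.exp_add]; ring_nf
          linear_combination bet * this
      _ ≤ _ := by
          have : Real.exp ((‖net.A‖ + lam) * (r - b)) ≤ Y :=
            Real.exp_le_exp.2 (mul_le_mul_of_nonneg_right (by linarith) (by linarith))
          gcongr
  have hsplit : agentFlow net.A (r - b) v - x i r = agentFlow net.A (r - b) (v - x i b) -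
      (x i r - agentFlow net.A (r - b) (x i b)) := by
    rw [map_sub]; abel
  rw [hsplit]
  calc _ ≤ Real.exp (-lam * r) * (bet * Y) + Real.exp (-lam * r) * (H * (Y - 1)) :=
        (norm_sub_le _ _).trans (add_le_add hfree hdev)
    _ = Real.exp (-lam * r) * ((Y * (bet + H)) - H) := by ring
    _ < Real.exp (-lam * r) * gam := by
        have := Real.exp_pos (-lam * r)
        gcongr
        linarith
    _ = _ := mul_comm _ _

/-- Either the delayed model agrees with the local one, whose error is below `β e^{-λr}`, or an
event less than `d` ago has not been received yet. Then the error was exactly at the threshold at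
that event and has drifted for less than `ε`. The initial phase is a drift from time 0. -/
lemma norm_delayed_error_lt (h : IsRun net bet lam d x y yd t T) (hx₀ : ∀ i, x i 0 = x₀ i)
    (hgraph : HasSpanningTree net.graph)
    (hS : net.IsJordanTransform S) (hdec : net.DecayBound S betaHat lamHat) (hbH : 0 < betaHat)
    (hbet : 0 < bet) (hgam : bet < gam) (hlam : 0 < lam) (hlt : lam < lamHat) (hcBF : net.cBF ≠ 0)
    (hH : ∀ s, 0 ≤ s → 0 < net.H₃ S x₀ gam lam betaHat lamHat s) (hd : 0 ≤ d)
    (heps : ∀ s, 0 ≤ s → d < net.epsAt S x₀ bet gam lam betaHat lamHat s)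
    {r : ℝ} (hr : 0 ≤ r) (hrT : (r : EReal) < T) (herr : ErrorBound x yd gam lam r)
    (i : Fin (M + 1)) : ‖yd i r - x i r‖ < gam * Real.exp (-lam * r) := by
  have hgam0 := hbet.trans hgam
  rcases lt_or_ge r d with hrd | hdr
  · have h1 := h.norm_drift_lt hx₀ hgraph hS hdec hbH hbet hgam0 hlam hlt hcBF le_rfl hr
      (hH 0 le_rfl) (by linarith [heps 0 le_rfl]) hrT herr (i := i) (v := yd i 0)
      (by simpa using h.yd_init i)
    rw [sub_zero] at h1
    rwa [h.yd_init_eq hr hrd hrT]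
  · obtain ⟨k, a, ha0, ha, har, hr'⟩ := h.exists_delayed_window i hd hrT hdr
    rw [h.yd_eq ha har hr' hrT]
    rcases lt_or_ge (r : EReal) (t i (k + 1)) with hlt' | hge
    · rw [← h.y_eq ha (by linarith) hlt' hrT]
      refine (h.no_event i k r (by rw [ha]; exact_mod_cast (by linarith : a ≤ r)) hlt' hrT).trans ?_
      have := Real.exp_pos (-lam * r)
      gcongr
    · rcases h.time_cases i (k + 1) with ht | ⟨b, hb0, hb⟩
      · rw [ht] at hge; exact absurd hge (by simp)
      · have hbr : b ≤ r := by rw [hb] at hge; exact_mod_cast hge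
        have hrb : r < b + d := by rw [hb] at hr'; exact_mod_cast hr'
        have h1 := h.norm_drift_lt hx₀ hgraph hS hdec hbH hbet hgam0 hlam hlt hcBF hb0 hbr
          (hH b hb0) (by linarith [heps b hb0]) hrT herr (h.norm_at_event ha hb).le
        rwa [← flow_add_apply, sub_add_sub_cancel] at h1

/-- The delayed models stay within `gam * exp (-lam * s)` of the states. -/
lemma errorBound (h : IsRun net bet lam d x y yd t T) (hx₀ : ∀ i, x i 0 = x₀ i)
    (hgraph : HasSpanningTree net.graph)
    (hS : net.IsJordanTransform S) (hdec : net.DecayBound S betaHat lamHat) (hbH : 0 < betaHat)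
    (hbet : 0 < bet) (hgam : bet < gam) (hlam : 0 < lam) (hlt : lam < lamHat) (hcBF : net.cBF ≠ 0)
    (hH : ∀ s, 0 ≤ s → 0 < net.H₃ S x₀ gam lam betaHat lamHat s) (hd : 0 ≤ d)
    (heps : ∀ s, 0 ≤ s → d < net.epsAt S x₀ bet gam lam betaHat lamHat s)
    {r : ℝ} (hrT : (r : EReal) < T) : ErrorBound x yd gam lam r := by
  by_contra hbad
  simp only [ErrorBound, not_forall, not_le] at hbad
  obtain ⟨s₀, hs₀0, hs₀r, j₀, hj₀⟩ := hbad
  -- The delayed models jump at updates, so only right continuity is available at `c = sInf U`; the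
  -- strict bound at `c` excludes violations at and shortly after `c`.
  set U : Set ℝ := {s | 0 ≤ s ∧ ∃ j, gam * Real.exp (-lam * s) < ‖yd j s - x j s‖} with hU
  have hUne : U.Nonempty := ⟨s₀, hs₀0, j₀, hj₀⟩
  have hUbdd : BddBelow U := ⟨0, fun s hs => hs.1⟩
  set c := sInf U with hc
  have hc0 : 0 ≤ c := le_csInf hUne fun s hs => hs.1
  have hcT : (c : EReal) < T :=
    (EReal.coe_le_coe_iff.2 ((csInf_le hUbdd ⟨hs₀0, j₀, hj₀⟩).trans hs₀r.le)).trans_lt hrT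
  have herr : ErrorBound x yd gam lam c := fun s hs0 hsc j => by
    by_contra hcon
    exact notMem_of_lt_csInf hsc hUbdd ⟨hs0, j, not_le.1 hcon⟩
  have hev : ∀ᶠ s in 𝓝[≥] c, ∀ j, ‖yd j s - x j s‖ < gam * Real.exp (-lam * s) := by
    refine eventually_all.2 fun j => ?_
    have hx : ContinuousWithinAt (x j) (Ici c) c :=
      (h.x_deriv j c hc0 hcT).continuousWithinAt
    have hl := ((h.yd_continuousWithinAt j hd hc0 hcT).sub hx).norm
    have hr : ContinuousWithinAt (fun s => gam * Real.exp (-lam * s)) (Ici c) c :=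
      Continuous.continuousWithinAt (by fun_prop)
    exact hl.eventually_lt hr
      (h.norm_delayed_error_lt hx₀ hgraph hS hdec hbH hbet hgam hlam hlt hcBF hH hd heps hc0 hcT
        herr j)
  obtain ⟨e, hce, he⟩ := (mem_nhdsGE_iff_exists_Ico_subset).1 hev
  obtain ⟨s, hs, hse⟩ := exists_lt_of_csInf_lt hUne (show sInf U < e from hce)
  obtain ⟨j, hj⟩ := hs.2
  exact lt_asymm hj (he ⟨csInf_le hUbdd hs, hse⟩ j)

/-- The lower bound on the inter-event times. -/
lemma tauAt_le_sub (h : IsRun net bet lam d x y yd t T) (hx₀ : ∀ i, x i 0 = x₀ i)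
    (hgraph : HasSpanningTree net.graph)
    (hS : net.IsJordanTransform S) (hdec : net.DecayBound S betaHat lamHat) (hbH : 0 < betaHat)
    (hbet : 0 < bet) (hgam : bet < gam) (hlam : 0 < lam) (hlt : lam < lamHat) (hcBF : net.cBF ≠ 0)
    (hH : ∀ s, 0 ≤ s → 0 < net.H₃ S x₀ gam lam betaHat lamHat s) (hd : 0 ≤ d)
    (heps : ∀ s, 0 ≤ s → d < net.epsAt S x₀ bet gam lam betaHat lamHat s)
    {i : Fin (M + 1)} {k : ℕ} {a b : ℝ} (ha : t i k = a) (hb : t i (k + 1) = b) :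
    net.tauAt S x₀ bet gam lam betaHat lamHat a ≤ b - a := by
  have ha0 : 0 ≤ a := by have := h.time_nonneg i k; rw [ha] at this; exact_mod_cast this
  have hab : a < b := by
    have := h.event_lt i k (by rw [ha]; simp)
    rw [ha, hb] at this
    exact_mod_cast this
  have hbT : (b : EReal) < T := hb ▸ h.event_horizon i (k + 1) (by rw [hb]; simp)
  have herr := h.errorBound hx₀ hgraph hS hdec hbH hbet hgam hlam hlt hcBF hH hd heps hbT
  have hdev := h.norm_sub_agentFlow_le hx₀ hgraph hS hdec hbH (hbet.trans hgam) hlam hlt ha0 hab.le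
    (hH a ha0).le hcBF hbT herr i
  -- At the event the departure from free motion equals `β e^{-λb}`; cancelling the exponential and
  -- solving for `b - a` gives `τ`.
  rw [norm_sub_rev, h.norm_at_event ha hb, mul_comm bet] at hdev
  have hle := le_of_mul_le_mul_left hdev (Real.exp_pos _)
  have hHa := hH a ha0
  have hpL : 0 < ‖net.A‖ + lamHat := by linarith [norm_nonneg net.A]
  rw [Network.tauAt, div_le_iff₀ hpL, mul_comm]
  refine (Real.log_le_iff_le_exp (by positivity)).2 ?_
  have := (div_le_iff₀' hHa).2 hle
  linarith

lemma nat_mul_le_time (h : IsRun net bet lam d x y yd t T) {tau₀ : ℝ}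
    (htau : ∀ i k (a b : ℝ), t i k = a → t i (k + 1) = b → tau₀ ≤ b - a) (i : Fin (M + 1))
    (k : ℕ) : ((k * tau₀ : ℝ) : EReal) ≤ t i k := by
  induction k with
  | zero => simpa using h.time_nonneg i 0
  | succ k ih =>
    rcases h.time_cases i (k + 1) with ht | ⟨b, -, hb⟩
    · rw [ht]; exact le_top
    · rcases h.time_cases i k with ht | ⟨a, -, ha⟩
      · have := h.event_top i k ht
        rw [this] at hb
        exact absurd hb (by simp)
      · have h1 := htau i k a b ha hb
        rw [ha] at ih
        have h2 : (k : ℝ) * tau₀ ≤ a := by exact_mod_cast ih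
        rw [hb, EReal.coe_le_coe_iff]
        push_cast
        linarith

/-- A uniform lower bound on the inter-event times excludes Zeno behavior. -/
lemma horizon_eq_top (h : IsRun net bet lam d x y yd t T) {tau₀ : ℝ} (h0 : 0 < tau₀)
    (htau : ∀ i k (a b : ℝ), t i k = a → t i (k + 1) = b → tau₀ ≤ b - a) : T = ⊤ := by
  rw [h.horizon, iInf_eq_top]
  intro i
  refine EReal.eq_top_iff_forall_lt _ |>.2 fun R => ?_
  obtain ⟨k, hk⟩ := exists_nat_gt (R / tau₀)
  rw [div_lt_iff₀ h0] at hk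
  exact (EReal.coe_lt_coe_iff.2 hk).trans_le
    ((h.nat_mul_le_time htau i k).trans (le_iSup (t i) k))

lemma finite_events (h : IsRun net bet lam d x y yd t T) {tau₀ : ℝ} (h0 : 0 < tau₀)
    (htau : ∀ i k (a b : ℝ), t i k = a → t i (k + 1) = b → tau₀ ≤ b - a) (i : Fin (M + 1))
    (R : ℝ) : {k : ℕ | t i k ≤ (R : EReal)}.Finite := by
  refine (finite_Iic ⌊R / tau₀⌋₊).subset fun k hk => ?_
  have h1 : (k : ℝ) * tau₀ ≤ R :=
    EReal.coe_le_coe_iff.1 ((h.nat_mul_le_time htau i k).trans hk)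
  exact Nat.le_floor ((le_div_iff₀ h0).2 h1)

lemma achievesConsensus (h : IsRun net bet lam d x y yd t ⊤) (hx₀ : ∀ i, x i 0 = x₀ i)
    (hgraph : HasSpanningTree net.graph)
    (hS : net.IsJordanTransform S) (hdec : net.DecayBound S betaHat lamHat) (hbH : 0 < betaHat)
    (hgam : 0 < gam) (hlam : 0 < lam) (hlt : lam < lamHat)
    (herr : ∀ r, ErrorBound x yd gam lam r) : AchievesConsensus x := by
  have hexp : ∀ r : ℝ, 0 < r → Tendsto (fun s : ℝ => Real.exp (-r * s)) atTop (𝓝 0) := fun r hr =>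
    Real.tendsto_exp_atBot.comp (tendsto_id.const_mul_atTop_of_neg (neg_lt_zero.2 hr))
  have hbound : Tendsto (fun s : ℝ => betaHat * ‖xHatTail S x₀‖ * Real.exp (-lamHat * s) +
      net.gainQ S gam lam betaHat lamHat * (Real.exp (-lam * s) - Real.exp (-lamHat * s)))
      atTop (𝓝 0) := by
    have h1 := hexp lam hlam
    have h2 := hexp lamHat (hlam.trans hlt)
    simpa using (h2.const_mul (betaHat * ‖xHatTail S x₀‖)).add
      ((h1.sub h2).const_mul (net.gainQ S gam lam betaHat lamHat))
  intro i j
  -- The difference of two agents is a one-row block action on `x̂_{2:N}`, so it decays with it.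
  set D : Matrix (Fin 1) (Fin M) ℂ := Matrix.of fun _ k => S i k.succ - S j k.succ with hD
  have hdiff : ∀ s, ‖x i s - x j s‖ ≤ ‖D‖ * ‖xHatTail S fun l => x l s‖ := fun s => by
    rw [← norm_complexify]
    refine le_trans (le_of_eq ?_) ((norm_block_le _ 0).trans
      (norm_blockAction_le D (xHatTail S fun l => x l s)))
    congr 2
    ext q
    have := Network.sub_eq_sum_tail hgraph hS (fun l => (x l s q : ℂ)) i j
    simpa [xHatTail, Matrix.mulVec, dotProduct, hD] using this
  have hlim := hbound.const_mul ‖D‖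
  rw [mul_zero] at hlim
  refine squeeze_zero' (.of_forall fun s => norm_nonneg _) ?_ hlim
  filter_upwards [eventually_ge_atTop 0] with s hs
  exact (hdiff s).trans (mul_le_mul_of_nonneg_left (h.norm_xHatTail_le hx₀ hS hdec hbH hgam hlt hs
    (EReal.coe_lt_top s) (herr s)) (norm_nonneg _))

end Estimates

end IsRun

end EventConsensus

open EventConsensus in
theorem theorem2 {M n m : ℕ} (hM : 1 ≤ M) (hn : 1 ≤ n) (net : Network M n m)
    (hgraph : HasSpanningTree net.graph)
    (hctrl : Controllable net.A net.B)
    -- the gains `F = -BᵀP` and `c ≥ 1 / Re λ₂`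
    (alpha : ℝ) (halpha : 0 < alpha)
    (P : Matrix (Fin n) (Fin n) ℝ) (hP : P.PosDef)
    (hLMI : (-(P * net.A + net.Aᵀ * P - (2 : ℝ) • (P * net.B * net.Bᵀ * P)
      + (2 * alpha) • P)).PosDef)
    (hF : net.F = -(net.Bᵀ * P))
    (hc : ∀ μ ∈ spectrum ℂ net.laplacianC, μ ≠ 0 → 1 / μ.re ≤ net.c)
    -- the similarity transformation that brings the Laplacian to Jordan form
    (S : Matrix (Fin (M + 1)) (Fin (M + 1)) ℂ) (hS : net.IsJordanTransform S) :
    (∃ betaHat lamHat : ℝ, 0 < betaHat ∧ 0 < lamHat ∧ net.DecayBound S betaHat lamHat) ∧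
    ∀ betaHat lamHat : ℝ, 0 < betaHat → net.DecayBound S betaHat lamHat →
    ∀ bet gam lam : ℝ, 0 < bet → bet < gam → 0 < lam → lam < lamHat →
    ∀ x₀ : Fin (M + 1) → State n,
      (∀ s : ℝ, 0 ≤ s → 0 < net.H₃ S x₀ gam lam betaHat lamHat s) ∧
      ∃ eps > 0, ∃ tau₀ > 0,
        IsGLB (net.epsAt S x₀ bet gam lam betaHat lamHat '' Set.Ici 0) eps ∧
        IsGLB (net.tauAt S x₀ bet gam lam betaHat lamHat '' Set.Ici 0) tau₀ ∧
        ∀ d : ℝ, 0 ≤ d → d < eps →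
        ∀ (x y yd : Fin (M + 1) → ℝ → State n) (t : Fin (M + 1) → ℕ → EReal) (T : EReal),
          IsRun net bet lam d x y yd t T → (∀ i, x i 0 = x₀ i) →
            -- no Zeno behavior: the run exists for all time, with locally finitely many events
            T = ⊤ ∧
            (∀ i (R : ℝ), {k : ℕ | t i k ≤ (R : EReal)}.Finite) ∧
            -- asymptotic consensus
            AchievesConsensus x ∧
            -- lower bound on the inter-event times
            (∀ i k (a b : ℝ), t i k = a → t i (k + 1) = b →
              net.tauAt S x₀ bet gam lam betaHat lamHat a ≤ b - a ∧ tau₀ ≤ b - a) := by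
  refine ⟨Network.exists_decayBound hgraph halpha hP hLMI hF hc hS, ?_⟩
  intro betaHat lamHat hbH hdec bet gam lam hbet hgam hlam hlt x₀
  have hgam0 := hbet.trans hgam
  have hcBF := net.cBF_ne_zero hn hctrl (Network.gain_pos hM hgraph hS hc) hP hF
  have hH : ∀ s : ℝ, 0 ≤ s → 0 < net.H₃ S x₀ gam lam betaHat lamHat s := fun s hs =>
    Network.H₃_pos (net.laplacian_ne_zero hM hgraph) hcBF hgam0 hbH hlam hlt hs
  obtain ⟨eps, heps0, heps⟩ :=
    exists_isGLB_image_of_le (Network.exists_epsAt_ge hH hbet hgam hlam hlt)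
  obtain ⟨tau₀, htau0, htau⟩ :=
    exists_isGLB_image_of_le (Network.exists_tauAt_ge (bet := bet) hH hbet hlam hlt)
  refine ⟨hH, eps, heps0, tau₀, htau0, heps, htau, ?_⟩
  intro d hd hdeps x y yd t T hrun hx₀
  have hepsd : ∀ s, 0 ≤ s → d < net.epsAt S x₀ bet gam lam betaHat lamHat s := fun s hs =>
    hdeps.trans_le (heps.1 ⟨s, hs, rfl⟩)
  have hgap : ∀ i k (a b : ℝ), t i k = a → t i (k + 1) = b →
      net.tauAt S x₀ bet gam lam betaHat lamHat a ≤ b - a ∧ tau₀ ≤ b - a := by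
    intro i k a b ha hb
    have ha0 : 0 ≤ a := by have := hrun.time_nonneg i k; rw [ha] at this; exact_mod_cast this
    have h1 := hrun.tauAt_le_sub hx₀ hgraph hS hdec hbH hbet hgam hlam hlt hcBF hH hd hepsd ha hb
    exact ⟨h1, (htau.1 ⟨a, ha0, rfl⟩).trans h1⟩
  have hgap' := fun i k a b ha hb => (hgap i k a b ha hb).2
  obtain rfl := hrun.horizon_eq_top htau0 hgap'
  exact ⟨rfl, hrun.finite_events htau0 hgap', hrun.achievesConsensus hx₀ hgraph hS hdec hbH hgam0
    hlam hlt fun r => hrun.errorBound hx₀ hgraph hS hdec hbH hbet hgam hlam hlt hcBF hH hd hepsd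
      (EReal.coe_lt_top r), hgap⟩
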